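/- **Conventions.** Let $(\Omega,\mathcal F,\mathbb P)$ be a probability space and let $\mathbb X,\mathbb Y$ be Polish spaces, each with a complete distance $d$ generating its topology. A *continuous process* $X=(X(t))_{t\in\mathbb R}$ has measurable $X(t)$ and continuous trajectories; $\widetilde X(t)=X(t+\cdot)$ is then a random variable in $C_k(\mathbb R,\mathbb X)$, the space of continuous functions with the topology of uniform convergence on compact sets. The space of Borel probability measures on $C_k(\mathbb R,\mathbb X)$ carries the narrow topology, generated by the bounded Lipschitz distance $d_{BL}(\nu_1,\nu_2)=\sup\{\int\varphi\,d\nu_1-\int\varphi\,d\nu_2\}$ over continuous $\varphi$ with $|\varphi|\le 1$ that are $1$-Lipschitz for the distance $\sum_{k\ge1}2^{-k}\sup_{|t|\le k}(d(x(t),y(t))\wedge1)$. A continuous $u:\mathbb R\to S$ into a metric space is *almost periodic* if for every $\varepsilon>0$ there is $l>0$ such that every interval of length $l$ contains $\tau$ with $d(u(t+\tau),u(t))\le\varepsilon$ for all $t$. A continuous $u:\mathbb R\to S$ into a topological space is *almost automorphic* if every real sequence has a subsequence $(t_n)$ such that, for some $v:\mathbb R\to S$ and all $t$, $u(t+t_n)\to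 v(t)$ and $v(t-t_n)\to u(t)$. A continuous process $X$ is almost periodic (resp. almost automorphic) *in distribution* if $t\mapsto\mathrm{law}(\widetilde X(t))$ is almost periodic for $d_{BL}$ (resp. almost automorphic for the narrow topology). A map $f:\mathbb R\times\mathbb X\to\mathbb Y$ is *almost periodic in $t$ uniformly on compact sets* if every $f(\cdot,x)$ is continuous and, for every compact $K\subset\mathbb X$ and $\varepsilon>0$, there is $l>0$ such that every interval of length $l$ contains $\tau$ with $d(f(t+\tau,x),f(t,x))\le\varepsilon$ for all $t\in\mathbb R$, $x\in K$. It is *compact almost automorphic in $t$ uniformly on compact sets* if every real sequence has a subsequence $(t_n)$ such that, for some $\hat f:\mathbb R\times\mathbb X\to\mathbb Y$ with every $\hat f(\cdot,x)$ continuous, $f(t+t_n,x)\to\hat f(t,x)$ and $\hat f(t-t_n,x)\to f(t,x)$ for every $t$, uniformly for $x$ in every compact set. Let $\mu$ be a Borel measure on $\mathbb R$ with $\mu(\mathbb R)=\infty$ and $\mu(I)<\infty$ for bounded intervals $I$, and put $M_r(u)=\frac1{\mu([-r,r])}\int_{[-r,r]}u\,d\mu$. For Banach spaces $\mathbb X,\mathbb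 Y$, a continuous $h:\mathbb R\times\mathbb X\to\mathbb Y$ is *$\mu$-ergodic uniformly on compact sets* if every $h(\cdot,x)$ is bounded and $M_r(\|h(\cdot,x)\|)\to0$ as $r\to\infty$, uniformly for $x$ in every compact set. Let $p\ge0$, and set $|U|_p=(\mathbb E\|U\|^p)^{1/p}$ if $p>0$ and $|U|_0=\mathbb E(\|U\|\wedge1)$. A process $Z$ is *$\mu$-ergodic in $L^p$* if $t\mapsto Z(t)\in L^p(\Omega,\mathbb P)$ is continuous and bounded (in probability, with boundedness void, if $p=0$) and $M_r(|Z(\cdot)|_p)\to0$ as $r\to\infty$. A process $Y$ is *almost automorphic in $p$-distribution* if it is almost automorphic in distribution and, when $p>0$, $(\|Y(t)\|^p)_{t\in\mathbb R}$ is uniformly integrable. A continuous process $X$ is *$\mu$-pseudo almost automorphic in $p$-distribution* if $X=Y+Z$ with $Y$ almost automorphic in $p$-distribution and $Z$ $\mu$-ergodic in $L^p$. **Theorem (superposition lemma).** Let $X$ be a continuous $\mathbb X$-valued process and $f:\mathbb R\times\mathbb X\to\mathbb Y$ a continuous map. 1. If $X$ is almost periodic in distribution and $f$ is almost periodic in $t$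 uniformly on compact sets, then $f(\cdot,X(\cdot))$ is almost periodic in distribution. 2. If $X$ is almost automorphic in distribution and $f$ is compact almost automorphic in $t$ uniformly on compact sets, then $f(\cdot,X(\cdot))$ is almost automorphic in distribution. 3. Let $\mathbb X,\mathbb Y$ be separable Banach spaces, $\mu$ as above, and $p\ge0$. Assume that $f=g+h$, where $g$ is compact almost automorphic in $t$ uniformly on compact sets, $g(t,\cdot)$ is continuous for every $t$, and $h$ is $\mu$-ergodic uniformly on compact sets. Assume that for every $\varepsilon>0$ and every compact $K\subset\mathbb X$ there is $\eta>0$ such that, for all $x,y\in K$, $\|x-y\|\le\eta$ implies $\sup_{t}\|f(t,x)-f(t,y)\|\le\varepsilon$. If $p>0$, assume also that there are constants $C,L$ with $\|f(t,x)\|+\|g(t,x)\|\le C(1+\|x\|)$ and $\|f(t,x)-f(t,y)\|\le L\|x-y\|$ for all $t,x,y$. If $X$ is $\mu$-pseudo almost automorphic in $p$-distribution, then so is $f(\cdot,X(\cdot))$. -/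

import Mathlib

open MeasureTheory Filter Topology

/-! ### Almost periodic and almost automorphic functions of a real variable -/

/-- Almost periodicity of a function with values in a topological space `S` whose topology is
generated by the distance `d`: `f` is continuous and, for every `ε > 0`, there is a length `l > 0`
such that every interval of length `l` contains an `ε`-almost period of `f`. -/
def AlmostPeriodicWith {S : Type*} [TopologicalSpace S] (d : S → S → ℝ) (f : ℝ → S) : Prop :=
  Continuous f ∧ ∀ ε : ℝ, 0 < ε → ∃ l : ℝ, 0 < l ∧
    ∀ a : ℝ, ∃ τ ∈ Set.Icc a (a + l), ∀ t : ℝ, d (f (t + τ)) (f t) ≤ ε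

/-- (Bochner) almost automorphy of a function with values in a topological space. -/
def AlmostAutomorphic {S : Type*} [TopologicalSpace S] (f : ℝ → S) : Prop :=
  Continuous f ∧ ∀ t' : ℕ → ℝ, ∃ φ : ℕ → ℕ, StrictMono φ ∧ ∃ g : ℝ → S, ∀ t : ℝ,
    Tendsto (fun n => f (t + t' (φ n))) atTop (𝓝 (g t)) ∧
    Tendsto (fun n => g (t - t' (φ n))) atTop (𝓝 (f t))

/-- `f(t, y)` is almost periodic with respect to `t`, uniformly with respect to `y` in compact
subsets: on each compact set, the almost periods can be chosen independently of `y`. -/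
def AlmostPeriodicUniformlyOnCompacts {S T : Type*} [TopologicalSpace S] [MetricSpace T]
    (f : ℝ → S → T) : Prop :=
  (∀ y, Continuous fun t => f t y) ∧
  ∀ K : Set S, IsCompact K → ∀ ε : ℝ, 0 < ε → ∃ l : ℝ, 0 < l ∧
    ∀ a : ℝ, ∃ τ ∈ Set.Icc a (a + l), ∀ t : ℝ, ∀ y ∈ K, dist (f (t + τ) y) (f t y) ≤ ε

/-- `f(t, y)` is compact almost automorphic with respect to `t`, uniformly with respect to `y` in
compact subsets: every sequence `t'` has a subsequence `t_n = t' (φ n)` such that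
`f (t + t_n, y) → g (t, y)` and `g (t - t_n, y) → f (t, y)` for every `t`, uniformly with respect
to `y` in every compact set, where the limit function `g` is continuous with respect to `t`. -/
def CompactAlmostAutomorphicUniformlyOnCompacts {S T : Type*} [TopologicalSpace S] [MetricSpace T]
    (f : ℝ → S → T) : Prop :=
  ∀ t' : ℕ → ℝ, ∃ φ : ℕ → ℕ, StrictMono φ ∧ ∃ g : ℝ → S → T,
    (∀ y, Continuous fun t => g t y) ∧
    ∀ K : Set S, IsCompact K → ∀ t : ℝ,
      TendstoUniformlyOn (fun (n : ℕ) y => f (t + t' (φ n)) y) (g t) atTop K ∧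
      TendstoUniformlyOn (fun (n : ℕ) y => g (t - t' (φ n)) y) (f t) atTop K

/-! ### Ergodic perturbations -/

/-- The weights `μ`: Borel measures on `ℝ` of infinite total mass which are finite on bounded
intervals. -/
def IsWeight (μ : Measure ℝ) : Prop :=
  μ Set.univ = ⊤ ∧ ∀ a b : ℝ, μ (Set.Icc a b) < ⊤

/-- The average `1 / μ([-r, r]) ∫_{[-r, r]} u dμ`. -/
noncomputable def weightedMean (μ : Measure ℝ) (u : ℝ → ℝ) (r : ℝ) : ℝ :=
  (μ.real (Set.Icc (-r) r))⁻¹ * ∫ t in Set.Icc (-r) r, u t ∂μ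

/-- `μ`-ergodic functions: bounded continuous functions whose norm has asymptotic `μ`-mean `0`. -/
def Ergodic0 {F : Type*} [NormedAddCommGroup F] (μ : Measure ℝ) (h : ℝ → F) : Prop :=
  Continuous h ∧ (∃ C : ℝ, ∀ t, ‖h t‖ ≤ C) ∧
    Tendsto (weightedMean μ fun t => ‖h t‖) atTop (𝓝 0)

/-- Continuous functions `h(t, x)` which are `μ`-ergodic with respect to `t`, uniformly with respect
to `x` in compact subsets. -/
def ErgodicUniformlyOnCompacts {S F : Type*} [TopologicalSpace S] [NormedAddCommGroup F]
    (μ : Measure ℝ) (h : ℝ → S → F) : Prop :=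
  Continuous (Function.uncurry h) ∧ (∀ x, Ergodic0 μ fun t => h t x) ∧
    ∀ K : Set S, IsCompact K →
      TendstoUniformlyOn (fun (r : ℝ) x => weightedMean μ (fun t => ‖h t x‖) r)
        (fun _ => 0) atTop K

/-- The size of a random vector `U` in `L^p`: `(𝔼 ‖U‖^p)^(1/p)` if `p > 0`, and `𝔼 (‖U‖ ∧ 1)`
if `p = 0` (so that `lpSize P 0 (U - V)` is a distance of convergence in probability). -/
noncomputable def lpSize {Ω E : Type*} [MeasurableSpace Ω] [NormedAddCommGroup E]
    (P : Measure Ω) (p : ℝ) (U : Ω → E) : ℝ :=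
  if p = 0 then ∫ ω, min ‖U ω‖ 1 ∂P else (∫ ω, ‖U ω‖ ^ p ∂P) ^ (1 / p)

/-- `μ`-ergodic processes in `p`-th mean: `t ↦ Z t` is a bounded continuous map from `ℝ` to
`L^p(Ω, P, E)` whose size has asymptotic `μ`-mean `0`. For `p = 0`, `L^0` carries convergence in
probability and the boundedness condition is void. -/
def ErgodicProcess {Ω E : Type*} [MeasurableSpace Ω] [NormedAddCommGroup E]
    (P : Measure Ω) (μ : Measure ℝ) (p : ℝ) (Z : ℝ → Ω → E) : Prop :=
  (∀ t, MemLp (Z t) (ENNReal.ofReal p) P) ∧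
  (∀ t, Tendsto (fun s => lpSize P p (fun ω => Z s ω - Z t ω)) (𝓝 t) (𝓝 0)) ∧
  (∃ C : ℝ, ∀ t, lpSize P p (Z t) ≤ C) ∧
  Tendsto (weightedMean μ fun t => lpSize P p (Z t)) atTop (𝓝 0)

/-! ### Continuous processes and the laws of their translates in `C(ℝ, E)` -/

/-- Stochastic processes indexed by `ℝ` with continuous trajectories. -/
def IsContinuousProcess {Ω E : Type*} [MeasurableSpace Ω] [TopologicalSpace E] [MeasurableSpace E]
    (X : ℝ → Ω → E) : Prop :=
  (∀ t, Measurable (X t)) ∧ ∀ ω, Continuous fun t => X t ω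

/-- The Borel σ-algebra of `C(ℝ, E)` for the topology of uniform convergence on compact sets. -/
instance pathMeasurableSpace {E : Type*} [TopologicalSpace E] : MeasurableSpace C(ℝ, E) :=
  borel C(ℝ, E)

instance pathBorelSpace {E : Type*} [TopologicalSpace E] : BorelSpace C(ℝ, E) := ⟨rfl⟩

/-- The translated trajectory `X(t + ·)`, a random variable with values in `C(ℝ, E)`. -/
def translatedPath {Ω E : Type*} [MeasurableSpace Ω] [TopologicalSpace E] [MeasurableSpace E]
    (X : ℝ → Ω → E) (hX : IsContinuousProcess X) (t : ℝ) (ω : Ω) : C(ℝ, E) where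
  toFun s := X (t + s) ω
  continuous_toFun := (hX.2 ω).comp (continuous_const.add continuous_id)

theorem measurable_translatedPath {Ω E : Type*} [MeasurableSpace Ω] [MetricSpace E]
    [SecondCountableTopology E] [MeasurableSpace E] [BorelSpace E]
    (X : ℝ → Ω → E) (hX : IsContinuousProcess X) (t : ℝ) :
    Measurable (translatedPath X hX t) := by
  have hb : pathMeasurableSpace (E := E) = MeasurableSpace.generateFrom
      (Set.image2 (fun (K : Set ℝ) (U : Set E) => {f : C(ℝ, E) | Set.MapsTo f K U})
        {K | IsCompact K} {U | IsOpen U}) :=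
    borel_eq_generateFrom_of_subbasis ContinuousMap.compactOpen_eq
  rw [hb]
  refine measurable_generateFrom ?_
  rintro _ ⟨K, hK, U, hU, rfl⟩
  obtain ⟨D, hDK, hDc, hD⟩ :=
    (TopologicalSpace.IsSeparable.of_separableSpace K).exists_countable_dense_subset
  have key : translatedPath X hX t ⁻¹' {f : C(ℝ, E) | Set.MapsTo f K U} =
      ⋃ n : ℕ, ⋂ s ∈ D, {ω | (n : ENNReal)⁻¹ ≤ Metric.infEDist (X (t + s) ω) Uᶜ} := by
    ext ω
    have hc : Continuous fun s => Metric.infEDist (X (t + s) ω) Uᶜ :=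
      Metric.continuous_infEDist.comp (translatedPath X hX t ω).continuous
    have hpos : ∀ x, x ∈ U ↔ 0 < Metric.infEDist x Uᶜ := fun x => by
      rw [pos_iff_ne_zero, ne_eq, ← Metric.mem_closure_iff_infEDist_zero,
        hU.isClosed_compl.closure_eq, Set.mem_compl_iff, not_not]
    simp only [Set.mem_preimage, Set.mem_ofPred_eq, Set.mem_iUnion, Set.mem_iInter]
    constructor
    · intro h
      rcases K.eq_empty_or_nonempty with rfl | hne
      · exact ⟨0, fun s hs => absurd (hDK hs) (Set.notMem_empty s)⟩
      obtain ⟨s₀, hs₀, hmin⟩ := hK.exists_isMinOn hne hc.continuousOn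
      obtain ⟨n, hn⟩ := ENNReal.exists_inv_nat_lt ((hpos _).1 (h hs₀)).ne'
      exact ⟨n, fun s hs => hn.le.trans (hmin (hDK hs))⟩
    · rintro ⟨n, hn⟩ s hs
      have hcl : IsClosed {s | (n : ENNReal)⁻¹ ≤ Metric.infEDist (X (t + s) ω) Uᶜ} :=
        isClosed_le continuous_const hc
      have hsub := closure_minimal (fun s hs => hn s hs) hcl
      exact (hpos _).2 (lt_of_lt_of_le (by simp) (hsub (hD hs)))
  rw [key]
  exact MeasurableSet.iUnion fun n => MeasurableSet.biInter hDc fun s _ =>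
    measurableSet_le measurable_const (measurable_infEDist.comp (hX.1 _))

/-- The law of `X(t + ·)` as a Borel probability measure on `C(ℝ, E)`. -/
noncomputable def pathLaw {Ω E : Type*} [MeasurableSpace Ω] [MetricSpace E]
    [SecondCountableTopology E] [MeasurableSpace E] [BorelSpace E]
    (P : Measure Ω) [IsProbabilityMeasure P] (X : ℝ → Ω → E) (hX : IsContinuousProcess X) (t : ℝ) :
    ProbabilityMeasure C(ℝ, E) :=
  ⟨P.map (translatedPath X hX t),
    Measure.isProbabilityMeasure_map (measurable_translatedPath X hX t).aemeasurable⟩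

/-- The distance `∑_{k ≥ 1} 2^{-k} sup_{-k ≤ t ≤ k} (dist (x t) (y t) ∧ 1)`, which generates the
topology of uniform convergence on compact sets. -/
noncomputable def pathDist {E : Type*} [MetricSpace E] (x y : C(ℝ, E)) : ℝ :=
  ∑' k : ℕ, (1 / 2 : ℝ) ^ (k + 1) *
    ⨆ t : Set.Icc (-((k : ℝ) + 1)) ((k : ℝ) + 1), min (dist (x t) (y t)) 1

/-- The bounded Lipschitz distance associated with a distance `d`: the supremum of
`∫ φ dν₁ - ∫ φ dν₂` over all continuous `φ` bounded by `1` and `1`-Lipschitz for `d`. -/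
noncomputable def boundedLipschitzDist {S : Type*} [TopologicalSpace S] [MeasurableSpace S]
    (d : S → S → ℝ) (ν₁ ν₂ : ProbabilityMeasure S) : ℝ :=
  sSup {r : ℝ | ∃ φ : C(S, ℝ), (∀ x, |φ x| ≤ 1) ∧ (∀ x y, |φ x - φ y| ≤ d x y) ∧
    r = ∫ x, φ x ∂(ν₁ : Measure S) - ∫ x, φ x ∂(ν₂ : Measure S)}

section Distribution

variable {Ω E : Type*} [MeasurableSpace Ω] [MeasurableSpace E]

/-- `X` is almost periodic in distribution: `X` is a continuous process and `t ↦ law (X(t + ·))`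
is almost periodic. -/
def AlmostPeriodicInDistribution [MetricSpace E] [SecondCountableTopology E] [BorelSpace E]
    (P : Measure Ω) [IsProbabilityMeasure P] (X : ℝ → Ω → E) : Prop :=
  ∃ hX : IsContinuousProcess X,
    AlmostPeriodicWith (boundedLipschitzDist pathDist) (pathLaw P X hX)

/-- `X` is almost automorphic in distribution: `X` is a continuous process and
`t ↦ law (X(t + ·))` is almost automorphic for the narrow topology. -/
def AlmostAutomorphicInDistribution [MetricSpace E] [SecondCountableTopology E] [BorelSpace E]
    (P : Measure Ω) [IsProbabilityMeasure P] (X : ℝ → Ω → E) : Prop :=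
  ∃ hX : IsContinuousProcess X, AlmostAutomorphic (pathLaw P X hX)

/-- `X` is almost automorphic in `p`-distribution: moreover, if `p > 0`, the family
`(‖X t‖ ^ p)_t` is uniformly integrable. -/
def AlmostAutomorphicInPDistribution [NormedAddCommGroup E] [SecondCountableTopology E]
    [BorelSpace E] (P : Measure Ω) [IsProbabilityMeasure P] (p : ℝ) (X : ℝ → Ω → E) : Prop :=
  AlmostAutomorphicInDistribution P X ∧
    (0 < p → UniformIntegrable (fun (t : ℝ) ω => ‖X t ω‖ ^ p) 1 P)

/-- `X` is `μ`-pseudo almost automorphic in `p`-distribution: `X` is a continuous process of the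
form `X = Y + Z` with `Y` almost automorphic in `p`-distribution and `Z` `μ`-ergodic in `L^p`. -/
def PseudoAlmostAutomorphicInPDistribution [NormedAddCommGroup E] [SecondCountableTopology E]
    [BorelSpace E] (P : Measure Ω) [IsProbabilityMeasure P] (μ : Measure ℝ) (p : ℝ)
    (X : ℝ → Ω → E) : Prop :=
  IsContinuousProcess X ∧ ∃ Y Z : ℝ → Ω → E,
    AlmostAutomorphicInPDistribution P p Y ∧ ErgodicProcess P μ p Z ∧
    ∀ t ω, X t ω = Y t ω + Z t ω

end Distribution

/-!
Write `Φ_f` for the superposition operator `x ↦ f(·, x(·))` on path space. The law of the translate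
of `f(·, X(·))` by `t` is the image of the law of `X(t + ·)` under `Φ_{f(t + ·)}`, and everything
rests on the uniform continuity of `f` on the strips `ℝ × K`, `K` compact. For an almost periodic
`f` this is the usual argument with almost periods. For a compact almost automorphic `f`
(`uniformContinuous_of_translates_subseq_tendsto`) it comes from Baire's theorem: pointwise limits
of translates are continuous in `t`, hence determined by their values at rational times, so that on
some interval finitely many rational times control all translates at once; this gives
equicontinuity of the translates at one point, hence at every point.

*Almost automorphy.* On strips, uniform continuity upgrades pointwise convergence of the translates
of `f` to continuous convergence (`UniformlyContinuousOnStrips.tendsto_translate`), which passes to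
the operators `Φ` and then, by the continuous mapping theorem for continuously convergent maps
(`tendsto_probabilityMeasure_map`), to the laws. The limit function is uniformly continuous on
strips as well, so the same argument applies to the backward limit.

*Almost periodicity.* An almost periodic family of laws satisfies compact containment
(`AlmostPeriodicInDistribution.exists_isCompact`): on `[-k - 1, k + 1]` the translated paths stay in
a compact set `K`, up to a small probability. On the set of such paths, `φ ∘ Φ_{f(t + ·)}`, with `φ`
a test function for the bounded Lipschitz distance, has a modulus of continuity independent of `t`
and `φ`, so it is uniformly approximated by an `n`-Lipschitz function (`lipschitzEnvelope`) with `n`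
fixed. Common almost periods of the law of `X` and of the curve `t ↦ f(t, ·)` in `C(K, T)` are
then almost periods of the law of `f(·, X(·))`.

*Pseudo almost automorphy.* If `X = Y + Z` and `f = g + h`, then `f(t, X)` is the sum of
`g(t, Y)`, which is almost automorphic by the previous case, and of
`f(t, X) - f(t, Y) + h(t, Y)`. The increment is small where `Z` is: by the Lipschitz condition if
`p > 0`, and by tightness of `Y` and equicontinuity near compact sets if `p = 0`. As `Y` is tight
and `h = f - g` is equicontinuous on compact sets, `‖h(t, Y)‖` is dominated by finitely many
functions `‖h(t, x)‖` up to a small error, which uniform integrability controls outside a compact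
set.
-/

/-! ### Uniform continuity on strips -/

/-- Uniform continuity on every strip `ℝ × K` with `K` compact. -/
def UniformlyContinuousOnStrips {S T : Type*} [PseudoMetricSpace S] [PseudoMetricSpace T]
    (f : ℝ → S → T) : Prop :=
  ∀ K : Set S, IsCompact K → UniformContinuousOn (Function.uncurry f) (Set.univ ×ˢ K)

section Strips

variable {S T : Type*} [PseudoMetricSpace S] [PseudoMetricSpace T]

theorem UniformlyContinuousOnStrips.exists_delta {f : ℝ → S → T}
    (hf : UniformlyContinuousOnStrips f) {K : Set S} (hK : IsCompact K) {ε : ℝ} (hε : 0 < ε) :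
    ∃ δ > 0, ∀ t t' : ℝ, ∀ y ∈ K, ∀ y' ∈ K, dist t t' < δ → dist y y' < δ →
      dist (f t y) (f t' y') < ε := by
  obtain ⟨δ, hδ, h⟩ := Metric.uniformContinuousOn_iff.1 (hf K hK) ε hε
  exact ⟨δ, hδ, fun t t' y hy y' hy' ht hyy =>
    h (t, y) ⟨trivial, hy⟩ (t', y') ⟨trivial, hy'⟩ (max_lt ht hyy)⟩

theorem uniformlyContinuousOnStrips_of_forall_exists_delta {f : ℝ → S → T}
    (h : ∀ K : Set S, IsCompact K → ∀ ε > 0, ∃ δ > 0, ∀ t t' : ℝ, ∀ y ∈ K, ∀ y' ∈ K,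
      dist t t' < δ → dist y y' < δ → dist (f t y) (f t' y') ≤ ε) :
    UniformlyContinuousOnStrips f := by
  intro K hK
  refine Metric.uniformContinuousOn_iff.2 fun ε hε => ?_
  obtain ⟨δ, hδ, h⟩ := h K hK (ε / 2) (by positivity)
  refine ⟨δ, hδ, ?_⟩
  rintro ⟨t, y⟩ ⟨-, hy⟩ ⟨t', y'⟩ ⟨-, hy'⟩ hd
  exact (h t t' y hy y' hy' ((le_max_left _ _).trans_lt hd)
    ((le_max_right _ _).trans_lt hd)).trans_lt (by linarith)

/-- Uniform continuity on strips upgrades pointwise convergence of translates to continuous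
convergence: a convergent sequence together with its limit is a compact set. -/
theorem UniformlyContinuousOnStrips.tendsto_translate {ι : Type*} {l : Filter ι}
    [l.IsCountablyGenerated] {f g : ℝ → S → T} (hf : UniformlyContinuousOnStrips f) {s : ι → ℝ}
    (h : ∀ t y, Tendsto (fun i => f (t + s i) y) l (𝓝 (g t y))) (t : ℝ) (y : S) :
    Tendsto (fun q : ι × ℝ × S => f (q.2.1 + s q.1) q.2.2) (l ×ˢ 𝓝 (t, y)) (𝓝 (g t y)) := by
  refine tendsto_of_seq_tendsto fun u hu => ?_
  have h1 : Tendsto (fun n => (u n).1) atTop l := tendsto_fst.comp hu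
  have h2 : Tendsto (fun n => (u n).2) atTop (𝓝 (t, y)) := tendsto_snd.comp hu
  have h3 : Tendsto (fun n => (u n).2.1) atTop (𝓝 t) := (continuous_fst.tendsto _).comp h2
  have h4 : Tendsto (fun n => (u n).2.2) atTop (𝓝 y) := (continuous_snd.tendsto _).comp h2
  refine Metric.tendsto_nhds.2 fun ε hε => ?_
  obtain ⟨δ, hδ, hd⟩ := hf.exists_delta h4.isCompact_insert_range (half_pos hε)
  filter_upwards [Metric.tendsto_nhds.1 h3 δ hδ, Metric.tendsto_nhds.1 h4 δ hδ,
    h1.eventually (Metric.tendsto_nhds.1 (h t y) (ε / 2) (half_pos hε))] with n a b c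
  have := hd ((u n).2.1 + s (u n).1) (t + s (u n).1) (u n).2.2 (by simp) y (by simp)
    (by simpa using a) b
  calc dist (f ((u n).2.1 + s (u n).1) (u n).2.2) (g t y)
      ≤ _ := dist_triangle _ (f (t + s (u n).1) y) _
    _ < ε := by linarith

theorem UniformlyContinuousOnStrips.continuous {f : ℝ → S → T}
    (hf : UniformlyContinuousOnStrips f) : Continuous (Function.uncurry f) := by
  refine continuous_iff_continuousAt.2 fun ⟨t, y⟩ => ?_
  have := hf.tendsto_translate (l := (pure () : Filter Unit)) (s := fun _ => 0) (g := f)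
    (fun t y => by simpa using tendsto_const_nhds) t y
  simpa [ContinuousAt, Filter.pure_prod, Function.comp_def, Function.uncurry_def] using this

theorem UniformlyContinuousOnStrips.of_tendsto_translate {ι : Type*} {l : Filter ι} [l.NeBot]
    {f g : ℝ → S → T} (hf : UniformlyContinuousOnStrips f) {s : ι → ℝ}
    (h : ∀ t y, Tendsto (fun i => f (t + s i) y) l (𝓝 (g t y))) :
    UniformlyContinuousOnStrips g := by
  refine uniformlyContinuousOnStrips_of_forall_exists_delta fun K hK ε hε => ?_
  obtain ⟨δ, hδ, hd⟩ := hf.exists_delta hK hε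
  refine ⟨δ, hδ, fun t t' y hy y' hy' ht hyy => ?_⟩
  exact le_of_tendsto ((h t y).dist (h t' y')) (Eventually.of_forall fun i =>
    (hd _ _ y hy y' hy' (by simpa using ht) hyy).le)

end Strips

/-! ### Uniform continuity of almost periodic and compact almost automorphic functions -/

section UniformContinuity

variable {S T : Type*} [MetricSpace S] [MetricSpace T]

theorem AlmostPeriodicUniformlyOnCompacts.uniformlyContinuousOnStrips {f : ℝ → S → T}
    (hf : AlmostPeriodicUniformlyOnCompacts f) (hc : Continuous (Function.uncurry f)) :
    UniformlyContinuousOnStrips f := by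
  refine uniformlyContinuousOnStrips_of_forall_exists_delta fun K hK ε hε => ?_
  obtain ⟨l, hl, hτ⟩ := hf.2 K hK (ε / 3) (by positivity)
  have hcomp : IsCompact (Set.Icc (-1) (l + 1) ×ˢ K) := isCompact_Icc.prod hK
  obtain ⟨δ, hδ, hd⟩ := Metric.uniformContinuousOn_iff.1
    (hcomp.uniformContinuousOn_of_continuous hc.continuousOn) (ε / 3) (by positivity)
  refine ⟨min δ 1, lt_min hδ one_pos, fun t t' y hy y' hy' ht hyy => ?_⟩
  obtain ⟨τ, ⟨hτ1, hτ2⟩, hτ⟩ := hτ (-t)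
  have ht1 : |t - t'| < 1 := ht.trans_le (min_le_right _ _)
  rw [abs_lt] at ht1
  have key := hd (t + τ, y) ⟨⟨by linarith, by linarith⟩, hy⟩ (t' + τ, y')
    ⟨⟨by linarith, by linarith⟩, hy'⟩
    (max_lt (by simpa using ht.trans_le (min_le_left _ _)) (hyy.trans_le (min_le_left _ _)))
  have e1 := hτ t y hy
  have e2 := hτ t' y' hy'
  rw [dist_comm] at e1
  simp only [Function.uncurry] at key
  linarith [dist_triangle4 (f t y) (f (t + τ) y) (f (t' + τ) y') (f t' y')]

/-- A continuous function is uniformly continuous as soon as every sequence of its translates has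
a subsequence which converges pointwise to a member of a class `𝒢` of functions that are determined
by their values on the rationals. -/
theorem uniformContinuous_of_translates_subseq_tendsto {F : ℝ → T} (hF : Continuous F)
    (𝒢 : Set (ℝ → T)) (h : ∀ t' : ℕ → ℝ, ∃ φ : ℕ → ℕ, StrictMono φ ∧ ∃ G ∈ 𝒢, ∀ t,
      Tendsto (fun n => F (t + t' (φ n))) atTop (𝓝 (G t)))
    (sep : ∀ G ∈ 𝒢, ∀ G' ∈ 𝒢, (∀ q : ℚ, G q = G' q) → G = G') : UniformContinuous F := by
  obtain ⟨q, hq⟩ := exists_surjective_nat ℚ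
  refine Metric.uniformContinuous_iff.2 fun ε hε => ?_
  -- The translates of `F` are controlled at the times in `A k`, uniformly in the translation, by
  -- their values at the first `k` rationals.
  let A : ℕ → Set ℝ := fun k => ⋂ (s : ℝ) (s' : ℝ)
    (_ : ∀ i < k, dist (F (q i + s)) (F (q i + s')) ≤ 1 / ((k : ℝ) + 1)),
    {t | dist (F (t + s)) (F (t + s')) ≤ ε / 4}
  have hA : ∀ k, IsClosed (A k) := fun k =>
    isClosed_iInter fun s => isClosed_iInter fun s' => isClosed_iInter fun _ =>
      isClosed_le (by fun_prop) continuous_const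
  have hU : ⋃ k, A k = Set.univ := by
    refine Set.eq_univ_of_forall fun t => ?_
    by_contra hcon
    simp only [A, Set.mem_iUnion, Set.mem_iInter, Set.mem_ofPred_eq, not_exists, not_forall,
      not_le] at hcon
    choose s s' hs hbad using hcon
    obtain ⟨φ, hφ, G, hG, hGt⟩ := h s
    obtain ⟨ψ, hψ, G', hG', hGt'⟩ := h (s' ∘ φ)
    have hGt2 : ∀ t, Tendsto (fun n => F (t + s (φ (ψ n)))) atTop (𝓝 (G t)) := fun t =>
      (hGt t).comp hψ.tendsto_atTop
    have hmono : Tendsto (φ ∘ ψ) atTop atTop := (hφ.comp hψ).tendsto_atTop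
    have hEq : G = G' := by
      refine sep G hG G' hG' fun r => ?_
      obtain ⟨i, rfl⟩ := hq r
      refine dist_le_zero.1 ?_
      refine le_of_tendsto_of_tendsto ((hGt2 (q i)).dist (hGt' (q i)))
        ((tendsto_one_div_add_atTop_nhds_zero_nat (𝕜 := ℝ)).comp hmono) ?_
      filter_upwards [hmono.eventually_gt_atTop i] with n hn
      exact hs _ i hn
    have h0 := (hGt2 t).dist (hGt' t)
    rw [hEq, dist_self] at h0
    obtain ⟨n, hn⟩ := (h0.eventually_lt_const (by positivity : (0 : ℝ) < ε / 4)).exists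
    exact absurd hn (not_lt.2 (hbad _).le)
  -- Around `t₀` all translates are controlled; a sequence of bad pairs is moved there.
  obtain ⟨k, t₀, ht₀⟩ := nonempty_interior_of_iUnion_of_closed hA hU
  obtain ⟨δ₀, hδ₀, hball⟩ := Metric.mem_nhds_iff.1 (mem_interior_iff_mem_nhds.1 ht₀)
  by_contra hcon
  push Not at hcon
  have hpos : ∀ n : ℕ, (0 : ℝ) < 1 / ((n : ℝ) + 1) := fun n => Nat.one_div_pos_of_nat
  choose a b hab hfar using fun n : ℕ => hcon _ (hpos n)
  obtain ⟨φ, hφ, G, -, hG⟩ := h (fun n => a n - t₀)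
  have hcau : ∀ i < k, ∃ N, ∀ n ≥ N, ∀ m ≥ N,
      dist (F (q i + (a (φ n) - t₀))) (F (q i + (a (φ m) - t₀))) < 1 / ((k : ℝ) + 1) := fun i _ =>
    (Metric.cauchySeq_iff.1 (hG (q i)).cauchySeq) _ (hpos k)
  choose! N hN using hcau
  let M := (Finset.range k).sup N
  have hM : ∀ n ≥ M, ∀ i < k, dist (F (q i + (a (φ n) - t₀))) (F (q i + (a (φ M) - t₀)))
      ≤ 1 / ((k : ℝ) + 1) := fun n hn i hi => by
    have hi' : N i ≤ M := Finset.le_sup (f := N) (Finset.mem_range.2 hi)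
    exact (hN i hi n (hi'.trans hn) M hi').le
  have hctrl : ∀ n ≥ M, ∀ t, dist t t₀ < δ₀ →
      dist (F (t + (a (φ n) - t₀))) (F (t + (a (φ M) - t₀))) ≤ ε / 4 := fun n hn t ht => by
    have := hball (show t ∈ Metric.ball t₀ δ₀ from ht)
    simp only [A, Set.mem_iInter, Set.mem_ofPred_eq] at this
    exact this _ _ (hM n hn)
  have hlim : Tendsto (fun n => t₀ + (b (φ n) - a (φ n))) atTop (𝓝 t₀) := by
    have : Tendsto (fun n => b (φ n) - a (φ n)) atTop (𝓝 0) := by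
      refine squeeze_zero_norm (fun n => ?_)
        ((tendsto_one_div_add_atTop_nhds_zero_nat (𝕜 := ℝ)).comp hφ.tendsto_atTop)
      have := (hab (φ n)).le
      rwa [dist_comm, Real.dist_eq] at this
    simpa using tendsto_const_nhds.add this
  have hlim2 : Tendsto (fun n => F (t₀ + (b (φ n) - a (φ n)) + (a (φ M) - t₀))) atTop
      (𝓝 (F (t₀ + (a (φ M) - t₀)))) :=
    ((hF.comp (continuous_id.add continuous_const)).tendsto t₀).comp hlim
  obtain ⟨n, hn, hn1, hn2⟩ := ((eventually_ge_atTop M).and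
    ((Metric.tendsto_nhds.1 hlim δ₀ hδ₀).and
      (Metric.tendsto_nhds.1 hlim2 (ε / 4) (by positivity)))).exists
  have e1 := hctrl n hn t₀ (by simpa using hδ₀)
  have e2 := hctrl n hn _ hn1
  have e3 : t₀ + (a (φ n) - t₀) = a (φ n) := by ring
  have e4 : t₀ + (b (φ n) - a (φ n)) + (a (φ n) - t₀) = b (φ n) := by ring
  rw [e3] at e1
  rw [e4, dist_comm] at e2
  rw [dist_comm] at hn2
  have := hfar (φ n)
  have t1 := dist_triangle4 (F (a (φ n))) (F (t₀ + (a (φ M) - t₀)))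
    (F (t₀ + (b (φ n) - a (φ n)) + (a (φ M) - t₀))) (F (b (φ n)))
  linarith

/-- The restrictions to a compact set `K` form a continuous curve in `C(K, T)`, to which
`uniformContinuous_of_translates_subseq_tendsto` applies; equicontinuity in the second variable
comes from the relative compactness of this curve. -/
theorem CompactAlmostAutomorphicUniformlyOnCompacts.uniformlyContinuousOnStrips {f : ℝ → S → T}
    (hf : CompactAlmostAutomorphicUniformlyOnCompacts f) (hc : Continuous (Function.uncurry f)) :
    UniformlyContinuousOnStrips f := by
  refine uniformlyContinuousOnStrips_of_forall_exists_delta fun K hK ε hε => ?_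
  have : CompactSpace K := isCompact_iff_compactSpace.1 hK
  let F : ℝ → C(K, T) := ContinuousMap.curry
    ⟨fun q : ℝ × K => f q.1 q.2, hc.comp (continuous_fst.prodMk
      (continuous_subtype_val.comp continuous_snd))⟩
  have hF : Continuous F := ContinuousMap.continuous _
  let 𝒢 : Set (ℝ → C(K, T)) := {G | ∀ y, Continuous fun t => G t y}
  have hsub : ∀ t' : ℕ → ℝ, ∃ φ : ℕ → ℕ, StrictMono φ ∧ ∃ G ∈ 𝒢, ∀ t,
      Tendsto (fun n => F (t + t' (φ n))) atTop (𝓝 (G t)) := by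
    intro t'
    obtain ⟨φ, hφ, g, hg, hlim⟩ := hf t'
    have hgc : ∀ t, ContinuousOn (g t) K := fun t =>
      (hlim K hK t).1.continuousOn (Frequently.of_forall fun n =>
        (hc.comp (Continuous.prodMk_right (t + t' (φ n)))).continuousOn)
    refine ⟨φ, hφ, fun t => ⟨K.domRestrict (g t), (hgc t).domRestrict⟩, fun y => hg y, fun t => ?_⟩
    rw [ContinuousMap.tendsto_iff_tendstoUniformly]
    exact tendstoUniformlyOn_iff_tendstoUniformly_comp_coe.1 (hlim K hK t).1
  have hu : UniformContinuous F := by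
    refine uniformContinuous_of_translates_subseq_tendsto hF 𝒢 hsub fun G hG G' hG' hq => ?_
    funext t
    ext y
    exact congrFun (Rat.denseRange_cast.equalizer (hG y) (hG' y)
      (funext fun q => by simp [hq q])) t
  obtain ⟨δ₁, hδ₁, h1⟩ := Metric.uniformContinuous_iff.1 hu (ε / 2) (by positivity)
  have h2 : ∃ δ > 0, ∀ t : ℝ, ∀ y y' : K, dist y y' < δ → dist (F t y) (F t y') ≤ ε / 2 := by
    by_contra hcon
    push Not at hcon
    have hpos : ∀ n : ℕ, (0 : ℝ) < 1 / ((n : ℝ) + 1) := fun n => Nat.one_div_pos_of_nat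
    choose t y y' hyy hfar using fun n : ℕ => hcon _ (hpos n)
    obtain ⟨φ, hφ, G, -, hG⟩ := hsub t
    have hG0 := Metric.tendsto_nhds.1 (hG 0) (ε / 8) (by positivity)
    simp only [zero_add] at hG0
    obtain ⟨δ, hδ, hGd⟩ := Metric.uniformContinuous_iff.1
      (CompactSpace.uniformContinuous_of_continuous (G 0).continuous) (ε / 8) (by positivity)
    obtain ⟨n, hn1, hn2⟩ := (hG0.and (((tendsto_one_div_add_atTop_nhds_zero_nat
      (𝕜 := ℝ)).comp hφ.tendsto_atTop).eventually_lt_const hδ)).exists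
    have e1 := ContinuousMap.dist_apply_le_dist (f := F (t (φ n))) (g := G 0) (y (φ n))
    have e2 := ContinuousMap.dist_apply_le_dist (f := F (t (φ n))) (g := G 0) (y' (φ n))
    have e3 := hGd ((hyy (φ n)).trans hn2)
    have e4 := hfar (φ n)
    have t1 := dist_triangle4 (F (t (φ n)) (y (φ n))) (G 0 (y (φ n))) (G 0 (y' (φ n)))
      (F (t (φ n)) (y' (φ n)))
    rw [dist_comm (G 0 (y' (φ n)))] at t1
    linarith
  obtain ⟨δ₂, hδ₂, h2⟩ := h2
  refine ⟨min δ₁ δ₂, lt_min hδ₁ hδ₂, fun t t' y hy y' hy' ht hyy => ?_⟩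
  have e1 := h1 (ht.trans_le (min_le_left _ _))
  have e2 := ContinuousMap.dist_apply_le_dist (f := F t) (g := F t') ⟨y, hy⟩
  have e3 : dist (f t' y) (f t' y') ≤ ε / 2 :=
    h2 t' ⟨y, hy⟩ ⟨y', hy'⟩ (hyy.trans_le (min_le_right _ _))
  have e4 : dist (f t y) (f t' y) ≤ ε / 2 := e2.trans e1.le
  linarith [dist_triangle (f t y) (f t' y) (f t' y')]

end UniformContinuity

/-! ### Superposition operators on path space and the continuous mapping theorem -/

section Nemytskii

variable {S T : Type*}

/-- The superposition operator `x ↦ f(·, x(·))` on path space. -/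
def nemytskii [TopologicalSpace S] [TopologicalSpace T] (f : ℝ → S → T)
    (hf : Continuous (Function.uncurry f)) (x : C(ℝ, S)) : C(ℝ, T) :=
  ⟨fun s => f s (x s), hf.comp (continuous_id.prodMk x.continuous)⟩

theorem continuous_nemytskii [TopologicalSpace S] [TopologicalSpace T] {f : ℝ → S → T}
    (hf : Continuous (Function.uncurry f)) : Continuous (nemytskii f hf) := by
  refine ContinuousMap.continuous_of_continuous_uncurry _ ?_
  exact hf.comp (continuous_snd.prodMk continuous_eval)

/-- Continuous convergence of integrands gives continuous convergence of superposition
operators. -/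
theorem tendsto_nemytskii [TopologicalSpace S] [MetricSpace T] {ι : Type*} {l : Filter ι}
    {f : ι → ℝ → S → T} {g : ℝ → S → T} (hf : ∀ i, Continuous (Function.uncurry (f i)))
    (hg : Continuous (Function.uncurry g))
    (h : ∀ t y, Tendsto (fun q : ι × ℝ × S => f q.1 q.2.1 q.2.2) (l ×ˢ 𝓝 (t, y)) (𝓝 (g t y)))
    (x : C(ℝ, S)) :
    Tendsto (fun q : ι × C(ℝ, S) => nemytskii (f q.1) (hf q.1) q.2) (l ×ˢ 𝓝 x)
      (𝓝 (nemytskii g hg x)) := by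
  rw [ContinuousMap.tendsto_iff_tendstoLocallyUniformly,
    tendstoLocallyUniformly_iff_forall_tendsto]
  intro s
  have hx : Tendsto (fun z : (ι × C(ℝ, S)) × ℝ => z.1.2 z.2) ((l ×ˢ 𝓝 x) ×ˢ 𝓝 s) (𝓝 (x s)) := by
    have : Tendsto (fun z : C(ℝ, S) × ℝ => z.1 z.2) (𝓝 x ×ˢ 𝓝 s) (𝓝 (x s)) := by
      rw [← nhds_prod_eq]
      exact (continuous_eval (F := C(ℝ, S))).tendsto (x, s)
    exact this.comp ((tendsto_snd.comp tendsto_fst).prodMk tendsto_snd)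
  have h1 : Tendsto (fun z : (ι × C(ℝ, S)) × ℝ => f z.1.1 z.2 (z.1.2 z.2)) ((l ×ˢ 𝓝 x) ×ˢ 𝓝 s)
      (𝓝 (g s (x s))) := by
    have h3 : Tendsto (fun z : (ι × C(ℝ, S)) × ℝ => (z.1.1, z.2, z.1.2 z.2))
        ((l ×ˢ 𝓝 x) ×ˢ 𝓝 s) (l ×ˢ 𝓝 (s, x s)) := by
      rw [nhds_prod_eq]
      exact (tendsto_fst.comp tendsto_fst).prodMk (tendsto_snd.prodMk hx)
    exact (h s (x s)).comp h3
  have h2 : Tendsto (fun z : (ι × C(ℝ, S)) × ℝ => g z.2 (x z.2)) ((l ×ˢ 𝓝 x) ×ˢ 𝓝 s)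
      (𝓝 (g s (x s))) :=
    ((nemytskii g hg x).continuous.tendsto s).comp tendsto_snd
  exact (h2.prodMk_nhds h1).mono_right (nhds_le_uniformity _)

/-- Continuous mapping theorem for a sequence of maps which converges continuously. -/
theorem tendsto_probabilityMeasure_map {S T : Type*} [TopologicalSpace S] [MeasurableSpace S]
    [BorelSpace S] [HasOuterApproxClosed S] [TopologicalSpace T] [MeasurableSpace T]
    [BorelSpace T] [HasOuterApproxClosed T] {ν : ℕ → ProbabilityMeasure S}
    {ν₀ : ProbabilityMeasure S} (hν : Tendsto ν atTop (𝓝 ν₀)) {Φ : ℕ → S → T} {Φ₀ : S → T}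
    (hΦ : ∀ n, Measurable (Φ n)) (hΦ₀ : Measurable Φ₀)
    (h : ∀ x, Tendsto (fun q : ℕ × S => Φ q.1 q.2) (atTop ×ˢ 𝓝 x) (𝓝 (Φ₀ x))) :
    Tendsto (fun n => (ν n).map (hΦ n).aemeasurable) atTop (𝓝 (ν₀.map hΦ₀.aemeasurable)) := by
  refine tendsto_of_forall_isClosed_limsup_le' fun C hC => ?_
  -- `A m` decreases to a subset of `Φ₀ ⁻¹' C` by continuous convergence.
  let A : ℕ → Set S := fun m => closure (⋃ n ≥ m, Φ n ⁻¹' C)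
  have hAanti : Antitone A := fun m m' hm => closure_mono
    (Set.biUnion_subset_biUnion_left fun n (hn : m' ≤ n) => hm.trans hn)
  have hAsub : ⋂ m, A m ⊆ Φ₀ ⁻¹' C := by
    intro x hx
    by_contra hxC
    obtain ⟨N, hN⟩ : ∃ N : ℕ, ∃ U ∈ 𝓝 x, ∀ n ≥ N, ∀ y ∈ U, Φ n y ∉ C := by
      obtain ⟨a, ha, b, hb, hab⟩ := eventually_prod_iff.1
        ((h x).eventually (hC.isOpen_compl.mem_nhds hxC))
      obtain ⟨N, hN⟩ := eventually_atTop.1 ha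
      exact ⟨N, _, hb, fun n hn y hy => hab (hN n hn) hy⟩
    obtain ⟨U, hU, hN⟩ := hN
    obtain ⟨y, hyU, hy⟩ := mem_closure_iff_nhds.1 (Set.mem_iInter.1 hx N) U hU
    simp only [Set.mem_iUnion] at hy
    obtain ⟨n, hn, hy⟩ := hy
    exact hN n hn y hyU hy
  have hlim : Tendsto (fun m => (ν₀ : Measure S) (A m)) atTop (𝓝 ((ν₀ : Measure S) (⋂ m, A m))) :=
    tendsto_measure_iInter_atTop (fun m => isClosed_closure.measurableSet.nullMeasurableSet) hAanti
      ⟨0, measure_ne_top _ _⟩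
  have hmap : ∀ n, ((ν n).map (hΦ n).aemeasurable : Measure T) C
      = (ν n : Measure S) (Φ n ⁻¹' C) := fun n =>
    Measure.map_apply (hΦ n) hC.measurableSet
  have hmap₀ : (ν₀.map hΦ₀.aemeasurable : Measure T) C = (ν₀ : Measure S) (Φ₀ ⁻¹' C) :=
    Measure.map_apply hΦ₀ hC.measurableSet
  rw [hmap₀]
  refine le_trans ?_ (measure_mono hAsub)
  refine ge_of_tendsto hlim (Eventually.of_forall fun m => ?_)
  refine le_trans ?_ (ProbabilityMeasure.limsup_measure_closed_le_of_tendsto hν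
    (isClosed_closure (s := ⋃ n ≥ m, Φ n ⁻¹' C)))
  refine limsup_le_limsup ?_
  filter_upwards [eventually_ge_atTop m] with n hn
  rw [hmap n]
  exact measure_mono (subset_closure.trans'
    (Set.subset_biUnion_of_mem (u := fun n => Φ n ⁻¹' C) hn))

end Nemytskii

/-! ### Laws of translated paths; almost automorphy in distribution -/

section Paths

theorem continuous_uncurry_translate {S T : Type*} [TopologicalSpace S] [TopologicalSpace T]
    {f : ℝ → S → T} (hf : Continuous (Function.uncurry f))
    (t : ℝ) : Continuous (Function.uncurry fun s => f (t + s)) :=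
  hf.comp ((continuous_const.add continuous_fst).prodMk continuous_snd)

theorem IsContinuousProcess.superposition {Ω S T : Type*} [MeasurableSpace Ω] [TopologicalSpace S]
    [MeasurableSpace S] [BorelSpace S] [TopologicalSpace T] [MeasurableSpace T] [BorelSpace T]
    {X : ℝ → Ω → S} (hX : IsContinuousProcess X)
    {f : ℝ → S → T} (hf : Continuous (Function.uncurry f)) :
    IsContinuousProcess fun t ω => f t (X t ω) :=
  ⟨fun t => (hf.comp (Continuous.prodMk_right t)).measurable.comp (hX.1 t),
    fun ω => hf.comp (continuous_id.prodMk (hX.2 ω))⟩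

theorem continuous_translatedPath {Ω S : Type*} [MeasurableSpace Ω] [TopologicalSpace S]
    [MeasurableSpace S] {X : ℝ → Ω → S} (hX : IsContinuousProcess X) (ω : Ω) :
    Continuous fun t => translatedPath X hX t ω :=
  ContinuousMap.continuous_of_continuous_uncurry _
    ((hX.2 ω).comp (continuous_fst.add continuous_snd))

variable {Ω S T : Type*} [MeasurableSpace Ω] [MetricSpace S] [SecondCountableTopology S]
  [MeasurableSpace S] [BorelSpace S] [MetricSpace T] [SecondCountableTopology T]
  [MeasurableSpace T] [BorelSpace T]

theorem pathLaw_superposition (P : Measure Ω) [IsProbabilityMeasure P] {X : ℝ → Ω → S}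
    (hX : IsContinuousProcess X) {f : ℝ → S → T} (hf : Continuous (Function.uncurry f)) (t : ℝ) :
    pathLaw P (fun t ω => f t (X t ω)) (hX.superposition hf) t =
      (pathLaw P X hX t).map
        (continuous_nemytskii (continuous_uncurry_translate hf t)).measurable.aemeasurable := by
  apply Subtype.ext
  exact (Measure.map_map (continuous_nemytskii (continuous_uncurry_translate hf t)).measurable
    (measurable_translatedPath X hX t)).symm

theorem continuous_pathLaw (P : Measure Ω) [IsProbabilityMeasure P] {X : ℝ → Ω → S}
    (hX : IsContinuousProcess X) : Continuous (pathLaw P X hX) := by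
  refine continuous_iff_continuousAt.2 fun t => ?_
  refine ProbabilityMeasure.tendsto_iff_forall_integral_tendsto.2 fun φ => ?_
  have hmap : ∀ s, ∫ x, φ x ∂(pathLaw P X hX s : Measure C(ℝ, S)) =
      ∫ ω, φ (translatedPath X hX s ω) ∂P := fun s =>
    integral_map (measurable_translatedPath X hX s).aemeasurable
      φ.continuous.aestronglyMeasurable
  simp only [hmap]
  refine tendsto_integral_filter_of_dominated_convergence (fun _ => ‖φ‖) ?_ ?_
    (integrable_const _) ?_
  · exact Eventually.of_forall fun s => (φ.continuous.measurable.comp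
      (measurable_translatedPath X hX s)).aestronglyMeasurable
  · exact Eventually.of_forall fun s => Eventually.of_forall fun ω => φ.norm_coe_le_norm _
  · exact Eventually.of_forall fun ω =>
      (φ.continuous.comp (continuous_translatedPath hX ω)).tendsto t

/-- Superposition preserves almost automorphy in distribution: the subsequence given by the law of
`X` and then by `f` produces the limit `(g(t + ·, ·))_* ν(t)`. -/
theorem AlmostAutomorphicInDistribution.superposition {P : Measure Ω} [IsProbabilityMeasure P]
    {X : ℝ → Ω → S} (hX : AlmostAutomorphicInDistribution P X) {f : ℝ → S → T}
    (hc : Continuous (Function.uncurry f)) (hf : CompactAlmostAutomorphicUniformlyOnCompacts f) :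
    AlmostAutomorphicInDistribution P fun t ω => f t (X t ω) := by
  obtain ⟨hX, -, hlaw⟩ := hX
  have hfu := hf.uniformlyContinuousOnStrips hc
  refine ⟨hX.superposition hc, continuous_pathLaw P _, fun t' => ?_⟩
  obtain ⟨φ, hφ, ν, hν⟩ := hlaw t'
  obtain ⟨ψ, hψ, g, -, hg⟩ := hf (t' ∘ φ)
  have hptf : ∀ t y, Tendsto (fun n => f (t + t' (φ (ψ n))) y) atTop (𝓝 (g t y)) := fun t y =>
    (hg {y} isCompact_singleton t).1.tendsto_at rfl
  have hptg : ∀ t y, Tendsto (fun n => g (t + -t' (φ (ψ n))) y) atTop (𝓝 (f t y)) := fun t y => by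
    simpa only [← sub_eq_add_neg, Function.comp_apply] using
      (hg {y} isCompact_singleton t).2.tendsto_at rfl
  have hgu := hfu.of_tendsto_translate hptf
  have hgc := hgu.continuous
  refine ⟨φ ∘ ψ, hφ.comp hψ, fun t => (ν t).map
    (continuous_nemytskii (continuous_uncurry_translate hgc t)).measurable.aemeasurable,
    fun t => ⟨?_, ?_⟩⟩
  · simp only [pathLaw_superposition P hX hc, Function.comp_apply]
    refine tendsto_probabilityMeasure_map ((hν t).1.comp hψ.tendsto_atTop)
      (fun n => (continuous_nemytskii (continuous_uncurry_translate hc _)).measurable)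
      (continuous_nemytskii (continuous_uncurry_translate hgc t)).measurable
      (tendsto_nemytskii (f := fun n s => f (t + t' (φ (ψ n)) + s)) (g := fun s => g (t + s))
        (fun n => continuous_uncurry_translate hc _) (continuous_uncurry_translate hgc t)
        fun s y => ?_)
    have := hfu.tendsto_translate (s := fun n => t + t' (φ (ψ n))) (l := atTop)
      (g := fun s => g (t + s)) (fun s y => by
        simpa only [add_comm, add_left_comm, add_assoc] using hptf (t + s) y) s y
    simpa only [add_comm, add_left_comm, add_assoc] using this
  · rw [pathLaw_superposition P hX hc]
    refine tendsto_probabilityMeasure_map ((hν t).2.comp hψ.tendsto_atTop)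
      (fun n => (continuous_nemytskii (continuous_uncurry_translate hgc _)).measurable)
      (continuous_nemytskii (continuous_uncurry_translate hc t)).measurable
      (tendsto_nemytskii (f := fun n s => g (t - t' (φ (ψ n)) + s)) (g := fun s => f (t + s))
        (fun n => continuous_uncurry_translate hgc _) (continuous_uncurry_translate hc t)
        fun s y => ?_)
    have := hgu.tendsto_translate (s := fun n => t + -t' (φ (ψ n))) (l := atTop)
      (g := fun s => f (t + s)) (fun s y => by
        simpa only [add_comm, add_left_comm, add_assoc] using hptg (t + s) y) s y
    simpa only [sub_eq_add_neg, add_comm, add_left_comm, add_assoc, Function.comp_apply] using this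

end Paths

/-! ### Pseudo-distances and Lipschitz envelopes -/

section PseudoDist

variable {S : Type*}

/-- The axioms of a pseudo-distance, for functions such as `pathDist` and `boundedLipschitzDist`
which are not registered as the `dist` of an instance. -/
structure IsPseudoDist (d : S → S → ℝ) : Prop where
  self : ∀ x, d x x = 0
  comm : ∀ x y, d x y = d y x
  triangle : ∀ x y z, d x z ≤ d x y + d y z

theorem IsPseudoDist.nonneg {d : S → S → ℝ} (hd : IsPseudoDist d) (x y : S) : 0 ≤ d x y := by
  have := hd.triangle x y x
  rw [hd.self, hd.comm y x] at this
  linarith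

/-- The pseudometric space structure defined by a pseudo-distance. -/
abbrev IsPseudoDist.toPseudoMetricSpace {d : S → S → ℝ} (hd : IsPseudoDist d) :
    PseudoMetricSpace S where
  dist := d
  dist_self := hd.self
  dist_comm := hd.comm
  dist_triangle := hd.triangle

/-- For nonempty `A`, the largest function which is `n`-Lipschitz for `d`, at most `1`, and at most
`u` on `A` (inf-convolution), when `u` is bounded below. -/
noncomputable def lipschitzEnvelope (d : S → S → ℝ) (n : ℝ) (u : S → ℝ) (A : Set S) (x : S) : ℝ :=
  min 1 (⨅ y : A, u y + n * d x y)

variable {d : S → S → ℝ} {n : ℝ} {u : S → ℝ} {A : Set S}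

theorem bddBelow_lipschitzEnvelope (hd : IsPseudoDist d) (hn : 0 ≤ n) (hu : ∀ x, -1 ≤ u x)
    (x : S) : BddBelow (Set.range fun y : A => u y + n * d x y) := by
  refine ⟨-1, ?_⟩
  rintro _ ⟨y, rfl⟩
  have := mul_nonneg hn (hd.nonneg x y)
  linarith [hu y]

theorem abs_lipschitzEnvelope_le [Nonempty A] (hd : IsPseudoDist d) (hn : 0 ≤ n)
    (hu : ∀ x, -1 ≤ u x) (x : S) : |lipschitzEnvelope d n u A x| ≤ 1 := by
  refine abs_le.2 ⟨le_min (by norm_num) (le_ciInf fun y => ?_), min_le_left _ _⟩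
  have := mul_nonneg hn (hd.nonneg x y)
  linarith [hu y]

theorem lipschitzEnvelope_le_add [Nonempty A] (hd : IsPseudoDist d) (hn : 0 ≤ n)
    (hu : ∀ x, -1 ≤ u x) (x y : S) :
    lipschitzEnvelope d n u A x ≤ lipschitzEnvelope d n u A y + n * d x y := by
  unfold lipschitzEnvelope
  have h0 := mul_nonneg hn (hd.nonneg x y)
  rw [← sub_le_iff_le_add]
  refine le_min ?_ (le_ciInf fun z => ?_)
  · linarith [min_le_left 1 (⨅ y : A, u y + n * d x y)]
  · have h1 := ciInf_le (bddBelow_lipschitzEnvelope (A := A) hd hn hu x) z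
    have h2 := mul_le_mul_of_nonneg_left (hd.triangle x y z) hn
    linarith [min_le_right 1 (⨅ y : A, u y + n * d x y)]

theorem abs_lipschitzEnvelope_sub_le [Nonempty A] (hd : IsPseudoDist d) (hn : 0 ≤ n)
    (hu : ∀ x, -1 ≤ u x) (x y : S) :
    |lipschitzEnvelope d n u A x - lipschitzEnvelope d n u A y| ≤ n * d x y := by
  have h1 := lipschitzEnvelope_le_add (A := A) hd hn hu x y
  have h2 := lipschitzEnvelope_le_add (A := A) hd hn hu y x
  rw [hd.comm y x] at h2
  exact abs_le.2 ⟨by linarith, by linarith⟩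

theorem lipschitzEnvelope_le (hd : IsPseudoDist d) (hn : 0 ≤ n) (hu : ∀ x, -1 ≤ u x) {x : S}
    (hx : x ∈ A) : lipschitzEnvelope d n u A x ≤ u x := by
  have := ciInf_le (bddBelow_lipschitzEnvelope (A := A) hd hn hu x) ⟨x, hx⟩
  simp only [hd.self, mul_zero, add_zero] at this
  exact (min_le_right _ _).trans this

/-- On `A` the envelope stays close to `u` if `u` has a modulus of continuity on `A` and `n` is
large compared with this modulus. -/
theorem abs_lipschitzEnvelope_sub_self_le (hd : IsPseudoDist d) (hn : 0 ≤ n)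
    (hu : ∀ x, |u x| ≤ 1) {η ε : ℝ} (hε : 0 ≤ ε) (hη : 2 ≤ n * η)
    (h : ∀ x ∈ A, ∀ y ∈ A, d x y < η → |u x - u y| ≤ ε) {x : S} (hx : x ∈ A) :
    |lipschitzEnvelope d n u A x - u x| ≤ ε := by
  have h1 := lipschitzEnvelope_le (A := A) hd hn (fun x => (abs_le.1 (hu x)).1) hx
  have : Nonempty A := ⟨⟨x, hx⟩⟩
  have hux := abs_le.1 (hu x)
  have h2 : u x - ε ≤ lipschitzEnvelope d n u A x := by
    refine le_min (by linarith) (le_ciInf fun y => ?_)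
    have huy := abs_le.1 (hu y)
    rcases lt_or_ge (d x y) η with hlt | hge
    · have := (abs_le.1 (h x hx y y.2 hlt)).2
      linarith [mul_nonneg hn (hd.nonneg x y)]
    · linarith [mul_le_mul_of_nonneg_left hge hn]
  exact abs_le.2 ⟨by linarith, by linarith⟩

theorem exists_lt_of_lipschitzEnvelope_lt_one [Nonempty A] (hn : 0 < n) {x : S}
    (hx : lipschitzEnvelope d n (fun _ => 0) A x < 1) : ∃ y ∈ A, d x y < 1 / n := by
  rcases min_lt_iff.1 hx with h | h
  · exact absurd h (lt_irrefl _)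
  obtain ⟨y, hy⟩ := exists_lt_of_ciInf_lt h
  refine ⟨y, y.2, ?_⟩
  rw [lt_div_iff₀ hn]
  linarith

theorem continuous_of_abs_sub_le [TopologicalSpace S]
    (hc : ∀ x, Tendsto (fun y => d y x) (𝓝 x) (𝓝 0)) {φ : S → ℝ}
    (h : ∀ x y, |φ x - φ y| ≤ n * d x y) : Continuous φ := by
  refine continuous_iff_continuousAt.2 fun x => ?_
  refine tendsto_iff_dist_tendsto_zero.2 ?_
  refine squeeze_zero (fun _ => dist_nonneg) (fun y => h y x) ?_
  simpa using (hc x).const_mul n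

end PseudoDist

/-! ### The bounded Lipschitz distance -/

section BoundedLipschitz

variable {S : Type*} [TopologicalSpace S] [MeasurableSpace S] {d : S → S → ℝ}

theorem integrable_of_abs_le_one {α : Type*} [MeasurableSpace α] (ν : Measure α)
    [IsFiniteMeasure ν] {u : α → ℝ} (hm : Measurable u) (hu : ∀ x, |u x| ≤ 1) : Integrable u ν :=
  Integrable.of_bound hm.aestronglyMeasurable 1 (Eventually.of_forall hu)

theorem abs_integral_le_one {α : Type*} [MeasurableSpace α] (ν : Measure α)
    [IsProbabilityMeasure ν] {u : α → ℝ} (hu : ∀ x, |u x| ≤ 1) : |∫ x, u x ∂ν| ≤ 1 := by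
  have hu' : ∀ᵐ x ∂ν, ‖u x‖ ≤ 1 := Eventually.of_forall hu
  simpa using norm_integral_le_of_norm_le_const hu'

theorem integral_sub_integral_le_boundedLipschitzDist (ν₁ ν₂ : ProbabilityMeasure S) (φ : C(S, ℝ))
    (h1 : ∀ x, |φ x| ≤ 1) (h2 : ∀ x y, |φ x - φ y| ≤ d x y) :
    ∫ x, φ x ∂(ν₁ : Measure S) - ∫ x, φ x ∂(ν₂ : Measure S) ≤ boundedLipschitzDist d ν₁ ν₂ := by
  refine le_csSup ⟨2, ?_⟩ ⟨φ, h1, h2, rfl⟩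
  rintro _ ⟨φ, h1, -, rfl⟩
  have e1 := abs_le.1 (abs_integral_le_one (ν₁ : Measure S) h1)
  have e2 := abs_le.1 (abs_integral_le_one (ν₂ : Measure S) h1)
  linarith

theorem boundedLipschitzDist_le (hd : IsPseudoDist d) {ν₁ ν₂ : ProbabilityMeasure S} {r : ℝ}
    (h : ∀ φ : C(S, ℝ), (∀ x, |φ x| ≤ 1) → (∀ x y, |φ x - φ y| ≤ d x y) →
      ∫ x, φ x ∂(ν₁ : Measure S) - ∫ x, φ x ∂(ν₂ : Measure S) ≤ r) :
    boundedLipschitzDist d ν₁ ν₂ ≤ r := by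
  refine csSup_le ⟨0, 0, by simp, by simpa using hd.nonneg, by simp⟩ ?_
  rintro _ ⟨φ, h1, h2, rfl⟩
  exact h φ h1 h2

theorem integral_sub_integral_le_mul_boundedLipschitzDist (ν₁ ν₂ : ProbabilityMeasure S)
    {n : ℝ} (hn : 1 ≤ n) (φ : C(S, ℝ)) (h1 : ∀ x, |φ x| ≤ 1)
    (h2 : ∀ x y, |φ x - φ y| ≤ n * d x y) :
    ∫ x, φ x ∂(ν₁ : Measure S) - ∫ x, φ x ∂(ν₂ : Measure S) ≤
      n * boundedLipschitzDist d ν₁ ν₂ := by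
  have hn0 : 0 < n := by linarith
  have key := integral_sub_integral_le_boundedLipschitzDist (d := d) ν₁ ν₂ (n⁻¹ • φ)
    (fun x => by
      simp only [ContinuousMap.coe_smul, Pi.smul_apply, smul_eq_mul, abs_mul, abs_inv,
        abs_of_pos hn0]
      exact mul_le_one₀ (inv_le_one_of_one_le₀ hn) (abs_nonneg _) (h1 x))
    (fun x y => by
      simp only [ContinuousMap.coe_smul, Pi.smul_apply, smul_eq_mul, ← mul_sub, abs_mul, abs_inv,
        abs_of_pos hn0]
      rw [inv_mul_le_iff₀ hn0]
      exact h2 x y)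
  simp only [ContinuousMap.coe_smul, Pi.smul_apply, smul_eq_mul, integral_const_mul,
    ← mul_sub] at key
  rwa [inv_mul_le_iff₀ hn0] at key

theorem IsPseudoDist.boundedLipschitzDist (hd : IsPseudoDist d) :
    IsPseudoDist (boundedLipschitzDist (S := S) d) := by
  have hle : ∀ ν₁ ν₂, _root_.boundedLipschitzDist d ν₁ ν₂ ≤
      _root_.boundedLipschitzDist (S := S) d ν₂ ν₁ := fun ν₁ ν₂ => by
    refine boundedLipschitzDist_le hd fun φ h1 h2 => ?_
    have := integral_sub_integral_le_boundedLipschitzDist (d := d) ν₂ ν₁ (-φ)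
      (by simpa using h1) (fun x y => by
        have := h2 y x
        rw [hd.comm] at this
        simpa [sub_eq_add_neg, add_comm] using this)
    simp only [ContinuousMap.coe_neg, Pi.neg_apply, integral_neg] at this
    linarith
  refine ⟨fun ν => le_antisymm ?_ ?_, fun ν₁ ν₂ => le_antisymm (hle _ _) (hle _ _),
    fun ν₁ ν₂ ν₃ => ?_⟩
  · exact boundedLipschitzDist_le hd fun φ _ _ => (sub_self _).le
  · simpa using integral_sub_integral_le_boundedLipschitzDist (d := d) ν ν 0 (by simp)
      (by simpa using hd.nonneg)
  · refine boundedLipschitzDist_le hd fun φ h1 h2 => ?_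
    have e1 := integral_sub_integral_le_boundedLipschitzDist (d := d) ν₁ ν₂ φ h1 h2
    have e2 := integral_sub_integral_le_boundedLipschitzDist (d := d) ν₂ ν₃ φ h1 h2
    linarith

/-- Integrals of functions bounded by `1` which are close on an event of large probability. -/
theorem integral_sub_integral_le_of_abs_sub_le_on {α : Type*} [MeasurableSpace α] (ν : Measure α)
    [IsProbabilityMeasure ν] {u v : α → ℝ} (hum : Measurable u) (hvm : Measurable v)
    (hu : ∀ x, |u x| ≤ 1) (hv : ∀ x, |v x| ≤ 1) {A : Set α} (hA : MeasurableSet A) {a ε : ℝ}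
    (ha : 0 ≤ a) (hε : ν.real Aᶜ ≤ ε) (h : ∀ x ∈ A, |u x - v x| ≤ a) :
    ∫ x, u x ∂ν - ∫ x, v x ∂ν ≤ a + 2 * ε := by
  rw [← integral_sub (integrable_of_abs_le_one ν hum hu) (integrable_of_abs_le_one ν hvm hv)]
  have hi : Integrable (Aᶜ.indicator fun _ => (2 : ℝ)) ν :=
    (integrable_const (2 : ℝ)).indicator hA.compl
  calc ∫ x, (u x - v x) ∂ν ≤ ∫ x, (a + Aᶜ.indicator (fun _ => (2 : ℝ)) x) ∂ν := by
        refine integral_mono ((integrable_of_abs_le_one ν hum hu).sub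
          (integrable_of_abs_le_one ν hvm hv)) ((integrable_const a).add hi) fun x => ?_
        by_cases hx : x ∈ A
        · simpa [hx] using (abs_le.1 (h x hx)).2
        · have := abs_le.1 (hu x)
          have := abs_le.1 (hv x)
          simp only [Set.mem_compl_iff, hx, not_false_eq_true, Set.indicator_of_mem]
          linarith
    _ = a + 2 * ν.real Aᶜ := by
        rw [integral_add (integrable_const a) hi, integral_indicator_const _ hA.compl]
        simp [mul_comm]
    _ ≤ a + 2 * ε := by linarith

end BoundedLipschitz

/-! ### The distance of path space -/

section PathDist

variable {E : Type*} [MetricSpace E]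

theorem bddAbove_range_min_dist {ι : Type*} (a b : ι → E) :
    BddAbove (Set.range fun i => min (dist (a i) (b i)) 1) :=
  ⟨1, by rintro _ ⟨i, rfl⟩; exact min_le_right _ _⟩

theorem pathDist_sup_nonneg (x y : C(ℝ, E)) (k : ℕ) :
    0 ≤ ⨆ t : Set.Icc (-((k : ℝ) + 1)) ((k : ℝ) + 1), min (dist (x t) (y t)) 1 :=
  Real.iSup_nonneg fun _ => le_min dist_nonneg zero_le_one

theorem pathDist_sup_le_one (x y : C(ℝ, E)) (k : ℕ) :
    ⨆ t : Set.Icc (-((k : ℝ) + 1)) ((k : ℝ) + 1), min (dist (x t) (y t)) 1 ≤ 1 :=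
  Real.iSup_le (fun _ => min_le_right _ _) zero_le_one

theorem summable_pathDist (x y : C(ℝ, E)) :
    Summable fun k : ℕ => (1 / 2 : ℝ) ^ (k + 1) *
      ⨆ t : Set.Icc (-((k : ℝ) + 1)) ((k : ℝ) + 1), min (dist (x t) (y t)) 1 := by
  refine Summable.of_nonneg_of_le
    (fun k => mul_nonneg (by positivity) (pathDist_sup_nonneg x y k))
    (fun k => mul_le_of_le_one_right (by positivity) (pathDist_sup_le_one x y k)) ?_
  exact (summable_nat_add_iff 1).2 summable_geometric_two

theorem min_dist_le_pathDist (x y : C(ℝ, E)) (k : ℕ) {s : ℝ}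
    (hs : s ∈ Set.Icc (-((k : ℝ) + 1)) ((k : ℝ) + 1)) :
    (1 / 2 : ℝ) ^ (k + 1) * min (dist (x s) (y s)) 1 ≤ pathDist x y := by
  refine le_trans ?_ ((summable_pathDist x y).le_tsum k fun j _ =>
    mul_nonneg (by positivity) (pathDist_sup_nonneg x y j))
  refine mul_le_mul_of_nonneg_left ?_ (by positivity)
  exact le_ciSup (bddAbove_range_min_dist (fun t : Set.Icc (-((k : ℝ) + 1)) ((k : ℝ) + 1) => x t)
    fun t => y t) ⟨s, hs⟩

theorem dist_lt_of_pathDist_lt {x y : C(ℝ, E)} {k : ℕ} {δ : ℝ} (hδ : δ ≤ 1)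
    (h : pathDist x y < (1 / 2 : ℝ) ^ (k + 1) * δ) {s : ℝ}
    (hs : s ∈ Set.Icc (-((k : ℝ) + 1)) ((k : ℝ) + 1)) : dist (x s) (y s) < δ := by
  have := lt_of_mul_lt_mul_left ((min_dist_le_pathDist x y k hs).trans_lt h) (by positivity)
  rcases min_lt_iff.1 this with h | h
  · exact h
  · linarith

/-- The tail of the series defining `pathDist` after the term of index `k` is at most
`2 ^ (-(k + 1))`. -/
theorem pathDist_le (x y : C(ℝ, E)) (k : ℕ) {a : ℝ} (ha : 0 ≤ a)
    (h : ∀ s ∈ Set.Icc (-((k : ℝ) + 1)) ((k : ℝ) + 1), dist (x s) (y s) ≤ a) :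
    pathDist x y ≤ a + (1 / 2 : ℝ) ^ (k + 1) := by
  have hgeo : Summable fun j : ℕ => (1 / 2 : ℝ) ^ (j + 1) :=
    (summable_nat_add_iff 1).2 summable_geometric_two
  have hsum : ∑' j : ℕ, (1 / 2 : ℝ) ^ (j + 1) = 1 := by
    simp_rw [pow_succ]
    rw [tsum_mul_right, tsum_geometric_two]
    norm_num
  unfold pathDist
  rw [← (summable_pathDist x y).sum_add_tsum_nat_add (k + 1)]
  refine add_le_add ?_ ?_
  · calc _ ≤ ∑ j ∈ Finset.range (k + 1), (1 / 2 : ℝ) ^ (j + 1) * a := by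
          refine Finset.sum_le_sum fun j hj => mul_le_mul_of_nonneg_left ?_ (by positivity)
          refine Real.iSup_le (fun t => (min_le_left _ _).trans (h t ?_)) ha
          have hjk : (j : ℝ) ≤ k := by
            exact_mod_cast Nat.lt_succ_iff.1 (Finset.mem_range.1 hj)
          exact ⟨by linarith [t.2.1], by linarith [t.2.2]⟩
      _ = (∑ j ∈ Finset.range (k + 1), (1 / 2 : ℝ) ^ (j + 1)) * a := by rw [Finset.sum_mul]
      _ ≤ 1 * a := by
          refine mul_le_mul_of_nonneg_right ?_ ha
          exact (hgeo.sum_le_tsum _ fun _ _ => by positivity).trans_eq hsum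
      _ = a := one_mul a
  · calc _ ≤ ∑' j : ℕ, (1 / 2 : ℝ) ^ (j + 1) * (1 / 2 : ℝ) ^ (k + 1) := by
          refine ((summable_nat_add_iff (k + 1)).2 (summable_pathDist x y)).tsum_le_tsum
            (fun j => ?_) (hgeo.mul_right _)
          refine (mul_le_of_le_one_right (by positivity) (pathDist_sup_le_one x y _)).trans_eq ?_
          rw [← pow_add]
          congr 1
          ring
      _ = (1 / 2 : ℝ) ^ (k + 1) := by rw [tsum_mul_right, hsum, one_mul]

theorem isPseudoDist_pathDist : IsPseudoDist (pathDist (E := E)) where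
  self x := by simp [pathDist]
  comm x y := by simp only [pathDist, dist_comm]
  triangle x y z := by
    unfold pathDist
    rw [← (summable_pathDist x y).tsum_add (summable_pathDist y z)]
    refine (summable_pathDist x z).tsum_le_tsum (fun k => ?_)
      ((summable_pathDist x y).add (summable_pathDist y z))
    rw [← mul_add]
    refine mul_le_mul_of_nonneg_left ?_ (by positivity)
    refine Real.iSup_le (fun t => ?_)
      (add_nonneg (pathDist_sup_nonneg x y k) (pathDist_sup_nonneg y z k))
    have e1 := le_ciSup (bddAbove_range_min_dist
      (fun t : Set.Icc (-((k : ℝ) + 1)) ((k : ℝ) + 1) => x t) fun t => y t) t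
    have e2 := le_ciSup (bddAbove_range_min_dist
      (fun t : Set.Icc (-((k : ℝ) + 1)) ((k : ℝ) + 1) => y t) fun t => z t) t
    refine le_trans ?_ (add_le_add e1 e2)
    have h1 := dist_triangle (x t) (y t) (z t)
    have h2 := dist_nonneg (x := x t) (y := y t)
    have h3 := dist_nonneg (x := y t) (y := z t)
    rcases le_total (dist (x t) (y t)) 1 with h4 | h4 <;>
      rcases le_total (dist (y t) (z t)) 1 with h5 | h5 <;>
      simp only [min_eq_left, min_eq_right, h4, h5]
    · exact (min_le_left _ _).trans h1
    · linarith [min_le_right (dist (x t) (z t)) 1]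
    · linarith [min_le_right (dist (x t) (z t)) 1]
    · linarith [min_le_right (dist (x t) (z t)) 1]

theorem tendsto_pathDist_nhds (x : C(ℝ, E)) : Tendsto (fun y => pathDist y x) (𝓝 x) (𝓝 0) := by
  refine Metric.tendsto_nhds.2 fun ε hε => ?_
  obtain ⟨k, hk⟩ := exists_pow_lt_of_lt_one (half_pos hε) (by norm_num : (1 / 2 : ℝ) < 1)
  have hu := (ContinuousMap.tendsto_iff_forall_isCompact_tendstoUniformlyOn.1
    (tendsto_id (x := 𝓝 x))) (Set.Icc (-((k : ℝ) + 1)) ((k : ℝ) + 1)) isCompact_Icc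
  filter_upwards [Metric.tendstoUniformlyOn_iff.1 hu (ε / 2) (half_pos hε)] with y hy
  have h1 := pathDist_le y x k (half_pos hε).le fun s hs => by
    rw [dist_comm]
    exact (hy s hs).le
  rw [Real.dist_eq, sub_zero, abs_of_nonneg (isPseudoDist_pathDist.nonneg y x)]
  have h2 : (1 / 2 : ℝ) ^ (k + 1) ≤ (1 / 2) ^ k :=
    pow_le_pow_of_le_one (by norm_num) (by norm_num) k.le_succ
  linarith

end PathDist

/-! ### Compact containment and tightness -/

section Containment

/-- In a complete space, random sets which lie in finite unions of arbitrarily small balls, up to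
small probabilities that are uniform in the index, lie in a compact set up to a small probability:
an intersection of finite unions of closed balls with radii tending to `0` is compact. -/
theorem exists_isCompact_of_finite_nets {ι Ω S : Type*} [MeasurableSpace Ω] [MetricSpace S]
    [CompleteSpace S] (P : Measure Ω) (A : ι → Ω → Set S)
    (h : ∀ δ : ℝ, 0 < δ → ∀ ε : ENNReal, ε ≠ 0 → ∃ F : Set S, F.Finite ∧
      ∀ i, P {ω | ¬ A i ω ⊆ ⋃ c ∈ F, Metric.closedBall c δ} ≤ ε) {ε : ENNReal} (hε : ε ≠ 0) :
    ∃ K : Set S, IsCompact K ∧ ∀ i, P {ω | ¬ A i ω ⊆ K} ≤ ε := by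
  obtain ⟨ε', hε', hsum⟩ := ENNReal.exists_pos_sum_of_countable' hε ℕ
  choose F hF hP using fun m : ℕ =>
    h (1 / ((m : ℝ) + 1)) Nat.one_div_pos_of_nat (ε' m) (hε' m).ne'
  refine ⟨⋂ m : ℕ, ⋃ c ∈ F m, Metric.closedBall c (1 / ((m : ℝ) + 1)), ?_, fun i => ?_⟩
  · refine TotallyBounded.isCompact_of_isClosed (Metric.totallyBounded_iff.2 fun r hr => ?_)
      (isClosed_iInter fun m => (hF m).isClosed_biUnion fun c _ => Metric.isClosed_closedBall)
    obtain ⟨m, hm⟩ := exists_nat_one_div_lt hr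
    exact ⟨F m, hF m, (Set.iInter_subset _ m).trans
      (Set.iUnion₂_mono fun c _ => Metric.closedBall_subset_ball hm)⟩
  · refine le_trans ?_ ((measure_iUnion_le fun m : ℕ =>
      {ω | ¬ A i ω ⊆ ⋃ c ∈ F m, Metric.closedBall c (1 / ((m : ℝ) + 1))}).trans
        ((ENNReal.tsum_le_tsum fun m => hP m i).trans hsum.le))
    refine measure_mono fun ω hω => ?_
    simpa only [Set.mem_ofPred_eq, Set.subset_iInter_iff, not_forall, Set.mem_iUnion] using hω

/-- A separable metric space is the increasing union of finite unions of balls of radius `δ`. -/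
theorem exists_monotone_cover_finite_balls (S : Type*) [MetricSpace S] [SecondCountableTopology S]
    [Nonempty S] {δ : ℝ} (hδ : 0 < δ) : ∃ U : ℕ → Set S, (∀ N, IsOpen (U N)) ∧ Monotone U ∧
      ⋃ N, U N = Set.univ ∧ ∀ N, ∃ F : Set S, F.Finite ∧ U N = ⋃ c ∈ F, Metric.ball c δ := by
  let c := TopologicalSpace.denseSeq S
  refine ⟨fun N => ⋃ i ∈ Set.Iio N, Metric.ball (c i) δ,
    fun N => isOpen_biUnion fun _ _ => Metric.isOpen_ball,
    fun N N' h => Set.biUnion_subset_biUnion_left (Set.Iio_subset_Iio h), ?_,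
    fun N => ⟨c '' Set.Iio N, (Set.finite_Iio N).image c, by rw [Set.biUnion_image]⟩⟩
  refine Set.eq_univ_of_forall fun x => ?_
  obtain ⟨_, hi, i, rfl⟩ := Metric.dense_iff.1 (TopologicalSpace.denseRange_denseSeq S) x δ hδ
  exact Set.mem_iUnion.2 ⟨i + 1, Set.mem_biUnion (Set.mem_Iio.2 i.lt_succ_self)
    (Metric.mem_ball_comm.1 hi)⟩

variable {Ω S : Type*} [MeasurableSpace Ω] [MetricSpace S] [SecondCountableTopology S]
  [MeasurableSpace S] [BorelSpace S]

/-- On a bounded time interval the trajectories of a continuous process stay, up to a small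
probability, in a finite union of small balls. -/
theorem IsContinuousProcess.exists_finite_net (P : Measure Ω) [IsProbabilityMeasure P]
    {X : ℝ → Ω → S} (hX : IsContinuousProcess X) (a b : ℝ) {δ : ℝ} (hδ : 0 < δ) {ε : ENNReal}
    (hε : ε ≠ 0) : ∃ F : Set S, F.Finite ∧
      P {ω | ¬ Set.MapsTo (fun s => X s ω) (Set.Icc a b) (⋃ c ∈ F, Metric.ball c δ)} ≤ ε := by
  obtain ⟨ω₀⟩ : Nonempty Ω := P.nonempty_of_neZero
  have : Nonempty S := ⟨X 0 ω₀⟩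
  obtain ⟨U, hUo, hUm, hUc, hUF⟩ := exists_monotone_cover_finite_balls S hδ
  let B : ℕ → Set Ω := fun N => {ω | ¬ Set.MapsTo (fun s => X s ω) (Set.Icc a b) (U N)}
  have hBm : ∀ N, MeasurableSet (B N) := fun N => by
    have := measurable_translatedPath X hX 0 (ContinuousMap.isOpen_setOfPred_mapsTo
      (isCompact_Icc (a := a) (b := b)) (hUo N)).measurableSet
    convert! this.compl using 1
    ext ω
    simp [B, translatedPath, Set.MapsTo]
  have hBa : Antitone B := fun N N' h ω hω hω' => hω (hω'.mono_right (hUm h))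
  have hBe : ⋂ N, B N = ∅ := by
    refine Set.eq_empty_of_forall_notMem fun ω hω => ?_
    obtain ⟨N, hN⟩ := (isCompact_Icc.image (hX.2 ω)).elim_directed_cover U hUo
      (hUc ▸ Set.subset_univ _) (Monotone.directed_le hUm)
    exact Set.mem_iInter.1 hω N (Set.image_subset_iff.1 hN)
  have hlim := tendsto_measure_iInter_atTop (μ := P) (fun N => (hBm N).nullMeasurableSet) hBa
    ⟨0, measure_ne_top _ _⟩
  rw [hBe, measure_empty] at hlim
  obtain ⟨N, hN⟩ := (hlim.eventually_lt_const (pos_iff_ne_zero.2 hε)).exists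
  obtain ⟨F, hF, hUN⟩ := hUF N
  exact ⟨F, hF, hUN ▸ hN.le⟩

/-- The one-dimensional marginals of a process which is almost automorphic in distribution are
tight: otherwise a sequence of laws which escape from larger and larger finite unions of balls has a
subsequence converging to a probability measure which escapes from all of them. -/
theorem AlmostAutomorphicInDistribution.exists_isCompact {P : Measure Ω} [IsProbabilityMeasure P]
    [CompleteSpace S] {Y : ℝ → Ω → S} (h : AlmostAutomorphicInDistribution P Y) {ε : ENNReal}
    (hε : ε ≠ 0) : ∃ K : Set S, IsCompact K ∧ ∀ t, P {ω | Y t ω ∉ K} ≤ ε := by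
  obtain ⟨hY, -, hlaw⟩ := h
  suffices hs : ∃ K : Set S, IsCompact K ∧ ∀ t, P {ω | ¬ ({Y t ω} : Set S) ⊆ K} ≤ ε by
    simpa only [Set.singleton_subset_iff] using hs
  refine exists_isCompact_of_finite_nets P (fun t ω => {Y t ω}) (fun δ hδ ε hε => ?_) hε
  simp only [Set.singleton_subset_iff]
  obtain ⟨ω₀⟩ : Nonempty Ω := P.nonempty_of_neZero
  have : Nonempty S := ⟨Y 0 ω₀⟩
  obtain ⟨U, hUo, hUm, hUc, hUF⟩ := exists_monotone_cover_finite_balls S hδ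
  suffices hN : ∃ N, ∀ t, P {ω | Y t ω ∉ U N} ≤ ε by
    obtain ⟨N, hN⟩ := hN
    obtain ⟨F, hF, hUN⟩ := hUF N
    refine ⟨F, hF, fun t => (hN t).trans' (measure_mono fun ω hω hω' => hω ?_)⟩
    rw [hUN] at hω'
    exact Set.iUnion₂_mono (fun c _ => Metric.ball_subset_closedBall) hω'
  by_contra hcon
  push Not at hcon
  choose t ht using hcon
  obtain ⟨φ, hφ, ν, hν⟩ := hlaw t
  let C : ℕ → Set C(ℝ, S) := fun M => {x | x 0 ∉ U M}
  have hC : ∀ M, IsClosed (C M) := fun M =>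
    (hUo M).isClosed_compl.preimage (continuous_eval_const (0 : ℝ))
  have hle : ∀ M, ε ≤ (ν 0 : Measure C(ℝ, S)) (C M) := fun M => by
    refine le_trans ?_ (ProbabilityMeasure.limsup_measure_closed_le_of_tendsto (hν 0).1 (hC M))
    refine le_limsup_of_frequently_le (Eventually.frequently ?_)
    filter_upwards [hφ.tendsto_atTop.eventually_ge_atTop M] with n hn
    refine (ht (φ n)).le.trans ?_
    refine le_trans ?_ (Measure.map_apply (measurable_translatedPath Y hY _)
      (hC M).measurableSet).ge
    refine measure_mono fun ω hω hω' => hω (hUm hn ?_)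
    simpa [translatedPath] using hω'
  have hlim := tendsto_measure_iInter_atTop (μ := (ν 0 : Measure C(ℝ, S)))
    (fun M => (hC M).measurableSet.nullMeasurableSet)
    (fun M M' h x hx hx' => hx (hUm h hx')) ⟨0, measure_ne_top _ _⟩
  have hCe : ⋂ M, C M = ∅ := by
    refine Set.eq_empty_of_forall_notMem fun x hx => ?_
    obtain ⟨M, hM⟩ := Set.mem_iUnion.1 (hUc.symm ▸ Set.mem_univ (x 0))
    exact Set.mem_iInter.1 hx M hM
  rw [hCe, measure_empty] at hlim
  exact hε (le_antisymm (ge_of_tendsto hlim (Eventually.of_forall hle)) zero_le)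

end Containment

/-! ### Common almost periods -/

section AlmostPeriods

/-- Every `ε > 0` has a relatively dense set of `ε`-almost periods. -/
def HasAlmostPeriods {S : Type*} [PseudoMetricSpace S] (u : ℝ → S) : Prop :=
  ∀ ε : ℝ, 0 < ε → ∃ l : ℝ, 0 < l ∧
    ∀ a : ℝ, ∃ τ ∈ Set.Icc a (a + l), ∀ t : ℝ, dist (u (t + τ)) (u t) ≤ ε

variable {S S' : Type*} [PseudoMetricSpace S] [PseudoMetricSpace S']

theorem HasAlmostPeriods.uniformContinuous {u : ℝ → S} (h : HasAlmostPeriods u)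
    (hu : Continuous u) : UniformContinuous u := by
  refine Metric.uniformContinuous_iff.2 fun ε hε => ?_
  obtain ⟨l, hl, hτ⟩ := h (ε / 3) (by positivity)
  obtain ⟨δ, hδ, hd⟩ := Metric.uniformContinuousOn_iff.1
    ((isCompact_Icc (a := (-1 : ℝ)) (b := l + 1)).uniformContinuousOn_of_continuous
      hu.continuousOn) (ε / 3) (by positivity)
  refine ⟨min δ 1, lt_min hδ one_pos, fun {t t'} ht => ?_⟩
  obtain ⟨τ, ⟨hτ1, hτ2⟩, hτ⟩ := hτ (-t)
  have ht1 : |t - t'| < 1 := ht.trans_le (min_le_right _ _)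
  rw [abs_lt] at ht1
  have key := hd (t + τ) ⟨by linarith, by linarith⟩ (t' + τ) ⟨by linarith, by linarith⟩
    (by simpa using ht.trans_le (min_le_left _ _))
  have e1 := hτ t
  rw [dist_comm] at e1
  linarith [dist_triangle4 (u t) (u (t + τ)) (u (t' + τ)) (u t'), hτ t']

/-- The translates of an almost periodic function are totally bounded for the uniform distance. -/
theorem HasAlmostPeriods.exists_finite_translates {u : ℝ → S} (h : HasAlmostPeriods u)
    (hu : Continuous u) {ε : ℝ} (hε : 0 < ε) :
    ∃ T : Set ℝ, T.Finite ∧ ∀ s, ∃ r ∈ T, ∀ t, dist (u (t + s)) (u (t + r)) ≤ ε := by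
  obtain ⟨l, hl, hτ⟩ := h (ε / 2) (by positivity)
  obtain ⟨δ, hδ, hd⟩ := Metric.uniformContinuous_iff.1 (h.uniformContinuous hu) (ε / 2)
    (by positivity)
  obtain ⟨T, -, hT, hcov⟩ := (isCompact_Icc (a := (0 : ℝ)) (b := l)).finite_cover_balls hδ
  refine ⟨T, hT, fun s => ?_⟩
  obtain ⟨τ, ⟨hτ1, hτ2⟩, hτ⟩ := hτ (s - l)
  obtain ⟨r, hr, hsr⟩ := Set.mem_iUnion₂.1
    (hcov (show s - τ ∈ Set.Icc 0 l from ⟨by linarith, by linarith⟩))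
  refine ⟨r, hr, fun t => ?_⟩
  have e1 := hτ (t + (s - τ))
  rw [show t + (s - τ) + τ = t + s by ring] at e1
  have e2 : dist (u (t + (s - τ))) (u (t + r)) < ε / 2 := hd (by simpa using hsr)
  linarith [dist_triangle (u (t + s)) (u (t + (s - τ))) (u (t + r))]

/-- Two almost periodic functions have a relatively dense set of common almost periods. -/
theorem HasAlmostPeriods.exists_common {u : ℝ → S} {v : ℝ → S'} (hu : HasAlmostPeriods u)
    (hv : HasAlmostPeriods v) (huc : Continuous u) (hvc : Continuous v) {ε ε' : ℝ} (hε : 0 < ε)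
    (hε' : 0 < ε') : ∃ l : ℝ, 0 < l ∧ ∀ a : ℝ, ∃ τ ∈ Set.Icc a (a + l), ∀ t : ℝ,
      dist (u (t + τ)) (u t) ≤ ε ∧ dist (v (t + τ)) (v t) ≤ ε' := by
  obtain ⟨T, hT, hTu⟩ := hu.exists_finite_translates huc (half_pos hε)
  obtain ⟨T', hT', hTv⟩ := hv.exists_finite_translates hvc (half_pos hε')
  choose r hr hru using hTu
  choose r' hr' hrv using hTv
  -- One representative `c` for each pair of classes of translations.
  have hrep : ∃ c : ℝ × ℝ → ℝ, ∀ s, r (c (r s, r' s)) = r s ∧ r' (c (r s, r' s)) = r' s := by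
    classical
    refine ⟨fun q => if h : ∃ s, r s = q.1 ∧ r' s = q.2 then h.choose else 0, fun s => ?_⟩
    have h : ∃ s', r s' = (r s, r' s).1 ∧ r' s' = (r s, r' s).2 := ⟨s, rfl, rfl⟩
    simp only [dif_pos h]
    exact h.choose_spec
  obtain ⟨c, hc⟩ := hrep
  obtain ⟨M, hM⟩ := ((hT.prod hT').image fun q => |c q|).bddAbove
  have hM' : ∀ s, |c (r s, r' s)| ≤ M := fun s =>
    hM ⟨(r s, r' s), ⟨hr s, hr' s⟩, rfl⟩
  have hM0 : 0 ≤ M := (abs_nonneg _).trans (hM' 0)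
  refine ⟨2 * M + 1, by positivity, fun a => ?_⟩
  set s := a + M with hs
  have hcs := abs_le.1 (hM' s)
  refine ⟨s - c (r s, r' s), ⟨by linarith, by linarith⟩, fun t => ?_⟩
  obtain ⟨h1, h2⟩ := hc s
  set c₀ := c (r s, r' s)
  have e : t + (s - c₀) = t - c₀ + s := by ring
  have e' : t - c₀ + c₀ = t := by ring
  constructor
  · have a1 := hru s (t - c₀)
    have a2 := hru c₀ (t - c₀)
    rw [h1, e', dist_comm] at a2
    rw [e]
    linarith [dist_triangle (u (t - c₀ + s)) (u (t - c₀ + r s)) (u t)]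
  · have a1 := hrv s (t - c₀)
    have a2 := hrv c₀ (t - c₀)
    rw [h2, e', dist_comm] at a2
    rw [e]
    linarith [dist_triangle (v (t - c₀ + s)) (v (t - c₀ + r' s)) (v t)]

/-- `HasAlmostPeriods.exists_common` for a curve `u` in a space whose distance `d` is not
registered as an instance. -/
theorem IsPseudoDist.exists_common_almostPeriods {S : Type*} {d : S → S → ℝ} (hd : IsPseudoDist d)
    {u : ℝ → S} {v : ℝ → S'} (huc : ∀ t, Tendsto (fun s => d (u s) (u t)) (𝓝 t) (𝓝 0))
    (hu : ∀ ε : ℝ, 0 < ε → ∃ l : ℝ, 0 < l ∧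
      ∀ a : ℝ, ∃ τ ∈ Set.Icc a (a + l), ∀ t : ℝ, d (u (t + τ)) (u t) ≤ ε)
    (hv : HasAlmostPeriods v) (hvc : Continuous v) {ε ε' : ℝ} (hε : 0 < ε) (hε' : 0 < ε') :
    ∃ l : ℝ, 0 < l ∧ ∀ a : ℝ, ∃ τ ∈ Set.Icc a (a + l), ∀ t : ℝ,
      d (u (t + τ)) (u t) ≤ ε ∧ dist (v (t + τ)) (v t) ≤ ε' := by
  let _ : PseudoMetricSpace S := hd.toPseudoMetricSpace
  exact HasAlmostPeriods.exists_common (u := u) hu hv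
    (continuous_iff_continuousAt.2 fun t => tendsto_iff_dist_tendsto_zero.2 (huc t)) hvc hε hε'

end AlmostPeriods

/-! ### Almost periodicity in distribution -/

section AlmostPeriodicLaws

variable {Ω S T : Type*} [MeasurableSpace Ω] [MetricSpace S] [SecondCountableTopology S]
  [MeasurableSpace S] [BorelSpace S] [MetricSpace T] [SecondCountableTopology T]
  [MeasurableSpace T] [BorelSpace T]

theorem integral_pathLaw (P : Measure Ω) [IsProbabilityMeasure P] {X : ℝ → Ω → S}
    (hX : IsContinuousProcess X) (t : ℝ) {φ : C(ℝ, S) → ℝ} (hφ : Continuous φ) :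
    ∫ x, φ x ∂(pathLaw P X hX t : Measure C(ℝ, S)) = ∫ ω, φ (translatedPath X hX t ω) ∂P :=
  integral_map (measurable_translatedPath X hX t).aemeasurable hφ.aestronglyMeasurable

theorem IsPseudoDist.continuous_uncurry {S : Type*} [TopologicalSpace S] {d : S → S → ℝ}
    (hd : IsPseudoDist d) (hc : ∀ x, Tendsto (fun y => d y x) (𝓝 x) (𝓝 0)) :
    Continuous (Function.uncurry d) := by
  refine continuous_iff_continuousAt.2 fun ⟨x, y⟩ => tendsto_iff_dist_tendsto_zero.2 ?_
  have h1 : Tendsto (fun q : S × S => d q.1 x + d q.2 y) (𝓝 (x, y)) (𝓝 (0 + 0)) :=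
    ((hc x).comp (continuous_fst.tendsto (x, y))).add ((hc y).comp (continuous_snd.tendsto (x, y)))
  rw [add_zero] at h1
  refine squeeze_zero (fun _ => dist_nonneg) (fun q => ?_) h1
  rw [Real.dist_eq]
  have e1 := hd.triangle q.1 x q.2
  have e2 := hd.triangle x y q.2
  have e3 := hd.triangle x q.1 y
  have e4 := hd.triangle q.1 q.2 y
  rw [hd.comm y] at e2
  rw [hd.comm x q.1] at e3
  simp only [Function.uncurry]
  exact abs_le.2 ⟨by linarith, by linarith⟩

theorem pathDist_le_two {S : Type*} [MetricSpace S] (x y : C(ℝ, S)) : pathDist x y ≤ 2 := by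
  have hgeo : Summable fun k : ℕ => (1 / 2 : ℝ) ^ k := summable_geometric_two
  rw [← tsum_geometric_two]
  refine (summable_pathDist x y).tsum_le_tsum (fun k => ?_) hgeo
  exact (mul_le_of_le_one_right (by positivity) (pathDist_sup_le_one x y k)).trans
    (pow_le_pow_of_le_one (by norm_num) (by norm_num) k.le_succ)

/-- The law of the translated path is continuous for the bounded Lipschitz distance. -/
theorem tendsto_boundedLipschitzDist_pathLaw (P : Measure Ω) [IsProbabilityMeasure P]
    {X : ℝ → Ω → S} (hX : IsContinuousProcess X) (t : ℝ) :
    Tendsto (fun s => boundedLipschitzDist pathDist (pathLaw P X hX s) (pathLaw P X hX t)) (𝓝 t)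
      (𝓝 0) := by
  have hd := isPseudoDist_pathDist (E := S)
  have hm : ∀ s, Measurable fun ω =>
      pathDist (translatedPath X hX s ω) (translatedPath X hX t ω) := fun s =>
    (hd.continuous_uncurry tendsto_pathDist_nhds).measurable.comp
      ((measurable_translatedPath X hX s).prodMk (measurable_translatedPath X hX t))
  have hb : ∀ s ω, ‖pathDist (translatedPath X hX s ω) (translatedPath X hX t ω)‖ ≤ 2 :=
    fun s ω => by
      rw [Real.norm_of_nonneg (hd.nonneg _ _)]
      exact pathDist_le_two _ _
  have hlim : Tendsto (fun s => ∫ ω, pathDist (translatedPath X hX s ω)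
      (translatedPath X hX t ω) ∂P) (𝓝 t) (𝓝 (∫ _, (0 : ℝ) ∂P)) := by
    refine tendsto_integral_filter_of_dominated_convergence (fun _ => (2 : ℝ)) ?_ ?_
      (integrable_const _) ?_
    · exact Eventually.of_forall fun s => (hm s).aestronglyMeasurable
    · exact Eventually.of_forall fun s => Eventually.of_forall (hb s)
    · exact Eventually.of_forall fun ω => (tendsto_pathDist_nhds _).comp
        ((continuous_translatedPath hX ω).tendsto t)
  rw [integral_zero] at hlim
  refine squeeze_zero (fun s => hd.boundedLipschitzDist.nonneg _ _) (fun s => ?_) hlim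
  refine boundedLipschitzDist_le hd fun φ h1 h2 => ?_
  have hi : ∀ s, Integrable (fun ω => φ (translatedPath X hX s ω)) P := fun s =>
    integrable_of_abs_le_one P (φ.continuous.measurable.comp (measurable_translatedPath X hX s))
      fun _ => h1 _
  rw [integral_pathLaw P hX _ φ.continuous, integral_pathLaw P hX _ φ.continuous,
    ← integral_sub (hi s) (hi t)]
  exact integral_mono ((hi s).sub (hi t))
    (Integrable.of_bound (hm s).aestronglyMeasurable 2 (Eventually.of_forall (hb s)))
    fun ω => (le_abs_self _).trans (h2 _ _)

/-- Compact containment: an almost periodic family of laws is carried, up to a small probability,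
by the paths which stay in a fixed compact set during `[-k - 1, k + 1]`. All the laws are close to
the laws at times in a bounded interval. -/
theorem AlmostPeriodicInDistribution.exists_isCompact {P : Measure Ω} [IsProbabilityMeasure P]
    [CompleteSpace S] {X : ℝ → Ω → S} (h : AlmostPeriodicInDistribution P X) (k : ℕ) {ε : ENNReal}
    (hε : ε ≠ 0) : ∃ K : Set S, IsCompact K ∧ ∀ t, P {ω | ¬ Set.MapsTo (fun s => X (t + s) ω)
      (Set.Icc (-((k : ℝ) + 1)) ((k : ℝ) + 1)) K} ≤ ε := by
  obtain ⟨hX, -, hap⟩ := h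
  simp only [Set.mapsTo_iff_image_subset]
  refine exists_isCompact_of_finite_nets P _ (fun δ hδ ε hε => ?_) hε
  obtain ⟨ε₀, hε₀, hε₁, hle⟩ : ∃ ε₀ : ℝ, 0 < ε₀ ∧ ε₀ ≤ 1 ∧ ENNReal.ofReal ε₀ ≤ ε := by
    refine ⟨(min ε 1).toReal, ENNReal.toReal_pos (by simp [hε]) (by simp), ?_, ?_⟩
    · exact ENNReal.toReal_le_of_le_ofReal zero_le_one (by simp)
    · exact ENNReal.ofReal_toReal_le.trans (min_le_left _ _)
  have hd := isPseudoDist_pathDist (E := S)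
  set I := Set.Icc (-((k : ℝ) + 1)) ((k : ℝ) + 1) with hI
  set δ' := min δ 1 / 2 with hδ'
  have hδ'0 : 0 < δ' := by positivity
  have hδ'1 : δ' ≤ 1 := by linarith [min_le_right δ 1]
  have hδ'δ : δ' + δ' ≤ δ := by linarith [min_le_left δ 1]
  have hc0 : 0 < (1 / 2 : ℝ) ^ (k + 1) * δ' := by positivity
  set n := 1 / ((1 / 2 : ℝ) ^ (k + 1) * δ') with hn
  have hn1 : 1 ≤ n := by
    rw [hn, le_div_iff₀ hc0, one_mul]
    exact mul_le_one₀ (pow_le_one₀ (by norm_num) (by norm_num)) hδ'0.le hδ'1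
  have hn0 : 0 < n := by linarith
  have hninv : 1 / n = (1 / 2 : ℝ) ^ (k + 1) * δ' := by rw [hn, one_div_one_div]
  obtain ⟨l, hl, hτ⟩ := hap (ε₀ / 2 / n) (by positivity)
  obtain ⟨F, hF, hFP⟩ := hX.exists_finite_net P (-((k : ℝ) + 1)) (l + (k + 1)) hδ'0
    (ε := ENNReal.ofReal (ε₀ / 2)) (by simpa using hε₀)
  refine ⟨F, hF, fun t => ?_⟩
  -- `1 - ψ` below is a Lipschitz version of the indicator of `A`.
  let A : Set C(ℝ, S) := {x | Set.MapsTo x I (⋃ c ∈ F, Metric.ball c δ')}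
  have hAm : MeasurableSet A := (ContinuousMap.isOpen_setOfPred_mapsTo isCompact_Icc
    (isOpen_biUnion fun _ _ => Metric.isOpen_ball)).measurableSet
  have hAP : ∀ r ∈ Set.Icc 0 l, P {ω | translatedPath X hX r ω ∉ A} ≤ ENNReal.ofReal (ε₀ / 2) := by
    refine fun r hr => hFP.trans' (measure_mono fun ω hω hω' => hω fun s hs => ?_)
    exact hω' ⟨by linarith [hr.1, hs.1], by linarith [hr.2, hs.2]⟩
  have hAne : Nonempty A := by
    rw [Set.nonempty_coe_sort, Set.nonempty_iff_ne_empty]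
    intro hA
    have := hAP 0 ⟨le_rfl, hl.le⟩
    simp only [hA, Set.mem_empty_iff_false, not_false_eq_true, Set.ofPred_true,
      measure_univ] at this
    rw [← ENNReal.ofReal_one, ENNReal.ofReal_le_ofReal_iff (by positivity)] at this
    linarith
  have hu : ∀ x : C(ℝ, S), -1 ≤ (fun _ => (0 : ℝ)) x := fun _ => by norm_num
  have hLip := abs_lipschitzEnvelope_sub_le (A := A) hd hn0.le hu
  let ψ : C(C(ℝ, S), ℝ) := ⟨lipschitzEnvelope pathDist n (fun _ => 0) A,
    continuous_of_abs_sub_le tendsto_pathDist_nhds hLip⟩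
  have hψ1 : ∀ x, |ψ x| ≤ 1 := abs_lipschitzEnvelope_le (A := A) hd hn0.le hu
  have hψ0 : ∀ x, 0 ≤ ψ x := fun x => le_min zero_le_one (Real.iInf_nonneg fun y => by
    simpa using mul_nonneg hn0.le (hd.nonneg x y))
  have hψA : ∀ x ∈ A, ψ x ≤ 0 := fun x hx => lipschitzEnvelope_le hd hn0.le hu hx
  -- An almost period brings the time `t` back to `[0, l]`.
  obtain ⟨τ, ⟨hτ1, hτ2⟩, hτ⟩ := hτ (-t)
  have hr : t + τ ∈ Set.Icc 0 l := ⟨by linarith, by linarith⟩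
  have hmψ : ∀ r, Measurable fun ω => ψ (translatedPath X hX r ω) := fun r =>
    ψ.continuous.measurable.comp (measurable_translatedPath X hX r)
  have hiψ : ∀ r, Integrable (fun ω => ψ (translatedPath X hX r ω)) P := fun r =>
    integrable_of_abs_le_one P (hmψ r) fun _ => hψ1 _
  have hmB : MeasurableSet {ω | translatedPath X hX (t + τ) ω ∉ A} :=
    measurable_translatedPath X hX (t + τ) hAm.compl
  have e1 : ∫ ω, ψ (translatedPath X hX (t + τ) ω) ∂P ≤ ε₀ / 2 := by
    calc _ ≤ ∫ ω, {ω | translatedPath X hX (t + τ) ω ∉ A}.indicator (fun _ => (1 : ℝ)) ω ∂P := by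
          refine integral_mono (hiψ _) ((integrable_const _).indicator hmB) fun ω => ?_
          by_cases hω : translatedPath X hX (t + τ) ω ∈ A
          · simpa [hω] using hψA _ hω
          · simpa [hω] using (abs_le.1 (hψ1 _)).2
      _ = P.real {ω | translatedPath X hX (t + τ) ω ∉ A} := by
          rw [integral_indicator_const _ hmB]
          simp
      _ ≤ ε₀ / 2 := ENNReal.toReal_le_of_le_ofReal (by positivity) (hAP _ hr)
  have e2 := integral_sub_integral_le_mul_boundedLipschitzDist (pathLaw P X hX t)
    (pathLaw P X hX (t + τ)) hn1 ψ hψ1 hLip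
  rw [integral_pathLaw P hX _ ψ.continuous, integral_pathLaw P hX _ ψ.continuous,
    hd.boundedLipschitzDist.comm] at e2
  have e3 : n * boundedLipschitzDist pathDist (pathLaw P X hX (t + τ)) (pathLaw P X hX t)
      ≤ ε₀ / 2 := by
    have := mul_le_mul_of_nonneg_left (hτ t) hn0.le
    rwa [mul_div_cancel₀ _ hn0.ne'] at this
  have e4 := mul_meas_ge_le_integral_of_nonneg (μ := P)
    (f := fun ω => ψ (translatedPath X hX t ω)) (Eventually.of_forall fun _ => hψ0 _) (hiψ t) 1
  rw [one_mul] at e4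
  refine le_trans (measure_mono fun ω hω => ?_) (((ENNReal.le_ofReal_iff_toReal_le
    (measure_ne_top _ _) hε₀.le).2 (by linarith! : P.real _ ≤ ε₀)).trans hle)
  by_contra hlt
  obtain ⟨y, hy, hxy⟩ := exists_lt_of_lipschitzEnvelope_lt_one hn0 (not_le.1 hlt)
  refine hω (Set.image_subset_iff.2 fun s hs => ?_)
  rw [hninv] at hxy
  have h1 := dist_lt_of_pathDist_lt hδ'1 hxy hs
  obtain ⟨c, hc, h2⟩ := Set.mem_iUnion₂.1 (hy hs)
  refine Set.mem_biUnion hc ?_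
  have h3 := dist_triangle (translatedPath X hX t ω s) (y s) c
  rw [Metric.mem_ball] at h2
  exact Metric.mem_closedBall.2 (show dist (translatedPath X hX t ω s) c ≤ δ by linarith)

/-- Superposition preserves almost periodicity in distribution. -/
theorem AlmostPeriodicInDistribution.superposition {P : Measure Ω} [IsProbabilityMeasure P]
    [CompleteSpace S] {X : ℝ → Ω → S} (hX : AlmostPeriodicInDistribution P X) {f : ℝ → S → T}
    (hc : Continuous (Function.uncurry f)) (hf : AlmostPeriodicUniformlyOnCompacts f) :
    AlmostPeriodicInDistribution P fun t ω => f t (X t ω) := by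
  have hcont := fun k (ε : ENNReal) (hε : ε ≠ 0) => hX.exists_isCompact k hε
  obtain ⟨hX, -, hap⟩ := hX
  refine ⟨hX.superposition hc, continuous_pathLaw P _, fun ε₀ hε₀ => ?_⟩
  -- Replacing `f(t + τ + ·)` by `f(t + ·)` costs `4 * ε`, so do the two passages between
  -- `φ ∘ Φ t` and its Lipschitz approximation, and the change of law costs `ε`.
  obtain ⟨ε, hε, rfl⟩ : ∃ ε : ℝ, 0 < ε ∧ 13 * ε = ε₀ := ⟨ε₀ / 13, by positivity, by ring⟩
  have hd := isPseudoDist_pathDist (E := S)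
  have hd' := isPseudoDist_pathDist (E := T)
  obtain ⟨k, hk⟩ := exists_pow_lt_of_lt_one hε (by norm_num : (1 / 2 : ℝ) < 1)
  have hk' : (1 / 2 : ℝ) ^ (k + 1) ≤ ε :=
    (pow_le_pow_of_le_one (by norm_num) (by norm_num) k.le_succ).trans hk.le
  obtain ⟨K, hK, hKP⟩ := hcont k (ENNReal.ofReal ε) (by simpa using hε)
  set I := Set.Icc (-((k : ℝ) + 1)) ((k : ℝ) + 1) with hI
  let A : Set C(ℝ, S) := {x | Set.MapsTo x I K}
  have hAm : MeasurableSet A :=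
    (ContinuousMap.isClosed_setOfPred_mapsTo hK.isClosed I).measurableSet
  have hAP : ∀ t, (pathLaw P X hX t : Measure C(ℝ, S)).real Aᶜ ≤ ε := fun t => by
    refine ENNReal.toReal_le_of_le_ofReal hε.le ?_
    refine (Measure.map_apply (measurable_translatedPath X hX t) hAm.compl).trans_le ?_
    exact hKP t
  obtain ⟨δ, hδ, hdelta⟩ := (hf.uniformlyContinuousOnStrips hc).exists_delta hK hε
  set η := (1 / 2 : ℝ) ^ (k + 1) * min δ 1 with hη
  have hη0 : 0 < η := mul_pos (by positivity) (lt_min hδ one_pos)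
  set n := 2 / η + 1 with hn
  have hn1 : 1 ≤ n := le_add_of_nonneg_left (by positivity)
  have hnη : 2 ≤ n * η := by
    rw [hn, add_mul, div_mul_cancel₀ _ hη0.ne']
    linarith
  let Φ : ℝ → C(ℝ, S) → C(ℝ, T) := fun t => nemytskii _ (continuous_uncurry_translate hc t)
  have hΦ : ∀ t, Continuous (Φ t) := fun t => continuous_nemytskii _
  have hΦA : ∀ t, ∀ x ∈ A, ∀ y ∈ A, pathDist x y < η → pathDist (Φ t x) (Φ t y) ≤ 2 * ε := by
    intro t x hx y hy hxy
    refine (pathDist_le _ _ k hε.le fun s hs => ?_).trans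
      (by linarith : ε + (1 / 2 : ℝ) ^ (k + 1) ≤ _)
    refine (hdelta (t + s) (t + s) _ (hx hs) _ (hy hs) (by simpa using hδ) ?_).le
    exact (dist_lt_of_pathDist_lt (min_le_right _ _) hxy hs).trans_le (min_le_left _ _)
  -- The restriction of `f` to `ℝ × K`, as an almost periodic curve in `C(K, T)`.
  have : CompactSpace K := isCompact_iff_compactSpace.1 hK
  let F : ℝ → C(K, T) := ContinuousMap.curry
    ⟨fun q : ℝ × K => f q.1 q.2, hc.comp (continuous_fst.prodMk
      (continuous_subtype_val.comp continuous_snd))⟩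
  have hFc : Continuous F := ContinuousMap.continuous _
  have hF : HasAlmostPeriods F := fun ε hε => by
    obtain ⟨l, hl, h⟩ := hf.2 K hK ε hε
    refine ⟨l, hl, fun a => ?_⟩
    obtain ⟨τ, hτ, h⟩ := h a
    exact ⟨τ, hτ, fun t => (ContinuousMap.dist_le hε.le).2 fun y => h t y y.2⟩
  have hn0 : 0 < n := by linarith
  obtain ⟨l, hl, hτ⟩ := hd.boundedLipschitzDist.exists_common_almostPeriods
    (tendsto_boundedLipschitzDist_pathLaw P hX) hap hF hFc (div_pos hε hn0) hε
  refine ⟨l, hl, fun a => ?_⟩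
  obtain ⟨τ, hτa, hτ⟩ := hτ a
  refine ⟨τ, hτa, fun t => boundedLipschitzDist_le hd' fun φ h1 h2 => ?_⟩
  have hΦm : ∀ t, Measurable fun x => φ (Φ t x) := fun t =>
    (φ.continuous.comp (hΦ t)).measurable
  have hmap : ∀ t, ∫ x, φ x ∂(pathLaw P (fun t ω => f t (X t ω)) (hX.superposition hc) t :
      Measure C(ℝ, T)) = ∫ x, φ (Φ t x) ∂(pathLaw P X hX t : Measure C(ℝ, S)) := fun t => by
    rw [pathLaw_superposition P hX hc t]
    exact integral_map (hΦ t).measurable.aemeasurable φ.continuous.aestronglyMeasurable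
  rw [hmap, hmap]
  -- `φ ∘ Φ t` is replaced by an `n`-Lipschitz function, where `n` does not depend on `t` and `φ`.
  obtain ⟨ψ, hψ1, hψL, hψA⟩ : ∃ ψ : C(C(ℝ, S), ℝ), (∀ x, |ψ x| ≤ 1) ∧
      (∀ x y, |ψ x - ψ y| ≤ n * pathDist x y) ∧ ∀ x ∈ A, |φ (Φ t x) - ψ x| ≤ 2 * ε := by
    rcases A.eq_empty_or_nonempty with hA | hA
    · exact ⟨0, by simp, fun x y => by simpa using mul_nonneg hn0.le (hd.nonneg x y), by simp [hA]⟩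
    have := hA.to_subtype
    have hu : ∀ x, -1 ≤ φ (Φ t x) := fun x => (abs_le.1 (h1 _)).1
    have hL := abs_lipschitzEnvelope_sub_le (A := A) hd hn0.le hu
    refine ⟨⟨_, continuous_of_abs_sub_le tendsto_pathDist_nhds hL⟩,
      abs_lipschitzEnvelope_le (A := A) hd hn0.le hu, hL, fun x hx => ?_⟩
    rw [abs_sub_comm]
    exact abs_lipschitzEnvelope_sub_self_le hd hn0.le (fun x => h1 (Φ t x)) (by positivity) hnη
      (fun x hx y hy hxy => (h2 _ _).trans (hΦA t x hx y hy hxy)) hx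
  have hψm := ψ.continuous.measurable
  have e1 := integral_sub_integral_le_of_abs_sub_le_on (pathLaw P X hX (t + τ) : Measure C(ℝ, S))
    (hΦm (t + τ)) (hΦm t) (fun x => h1 _) (fun x => h1 _) hAm (a := 2 * ε) (by positivity)
    (hAP (t + τ)) fun x hx => by
      refine (h2 _ _).trans ((pathDist_le _ _ k hε.le fun s hs => ?_).trans
        (by linarith : ε + (1 / 2 : ℝ) ^ (k + 1) ≤ _))
      have := (ContinuousMap.dist_le hε.le).1 (hτ (t + s)).2 ⟨x s, hx hs⟩
      rwa [add_right_comm] at this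
  have e2 := integral_sub_integral_le_of_abs_sub_le_on (pathLaw P X hX (t + τ) : Measure C(ℝ, S))
    (hΦm t) hψm (fun x => h1 _) hψ1 hAm (a := 2 * ε) (by positivity) (hAP (t + τ)) hψA
  have e3 := integral_sub_integral_le_mul_boundedLipschitzDist (pathLaw P X hX (t + τ))
    (pathLaw P X hX t) hn1 ψ hψ1 hψL
  have e4 := integral_sub_integral_le_of_abs_sub_le_on (pathLaw P X hX t : Measure C(ℝ, S))
    hψm (hΦm t) hψ1 (fun x => h1 _) hAm (a := 2 * ε) (by positivity) (hAP t) fun x hx => by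
      rw [abs_sub_comm]
      exact hψA x hx
  have e5 : n * boundedLipschitzDist pathDist (pathLaw P X hX (t + τ)) (pathLaw P X hX t) ≤ ε := by
    have := mul_le_mul_of_nonneg_left (hτ t).1 hn0.le
    rwa [mul_div_cancel₀ _ hn0.ne'] at this
  linarith

end AlmostPeriodicLaws

/-! ### Functions with null mean -/

section NullMean

/-- `u` is dominated, up to an arbitrarily small constant, by a function which is integrable on
bounded intervals and has asymptotic `μ`-mean `0`. Unlike the vanishing of the mean of `u` itself,
this condition is stable under sums and domination without measurability requirements. -/
def HasNullMean (μ : Measure ℝ) (u : ℝ → ℝ) : Prop :=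
  ∀ ε : ℝ, 0 < ε → ∃ w : ℝ → ℝ, (∀ r, IntegrableOn w (Set.Icc (-r) r) μ) ∧
    Tendsto (weightedMean μ w) atTop (𝓝 0) ∧ ∀ t, u t ≤ ε + w t

variable {μ : Measure ℝ} {u v : ℝ → ℝ}

theorem HasNullMean.of_tendsto (hi : ∀ r, IntegrableOn u (Set.Icc (-r) r) μ)
    (h : Tendsto (weightedMean μ u) atTop (𝓝 0)) : HasNullMean μ u :=
  fun _ hε => ⟨u, hi, h, fun t => by linarith⟩

theorem HasNullMean.of_forall_le
    (h : ∀ ε : ℝ, 0 < ε → ∃ w : ℝ → ℝ, HasNullMean μ w ∧ ∀ t, u t ≤ ε + w t) :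
    HasNullMean μ u := fun ε hε => by
  obtain ⟨w, hw, hu⟩ := h (ε / 2) (half_pos hε)
  obtain ⟨w', hi, hlim, hw'⟩ := hw (ε / 2) (half_pos hε)
  exact ⟨w', hi, hlim, fun t => by linarith [hu t, hw' t]⟩

theorem HasNullMean.mono (hv : HasNullMean μ v) (h : ∀ t, u t ≤ v t) : HasNullMean μ u :=
  .of_forall_le fun ε hε => ⟨v, hv, fun t => by linarith [h t]⟩

theorem hasNullMean_zero : HasNullMean μ fun _ => 0 :=
  .of_tendsto (fun _ => integrableOn_zero) (by
    refine tendsto_const_nhds.congr fun r => ?_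
    simp [weightedMean])

theorem HasNullMean.add (hu : HasNullMean μ u) (hv : HasNullMean μ v) :
    HasNullMean μ fun t => u t + v t := fun ε hε => by
  obtain ⟨w, hi, hlim, hw⟩ := hu (ε / 2) (half_pos hε)
  obtain ⟨w', hi', hlim', hw'⟩ := hv (ε / 2) (half_pos hε)
  refine ⟨fun t => w t + w' t, fun r => (hi r).add (hi' r), ?_,
    fun t => by linarith [hw t, hw' t]⟩
  have := hlim.add hlim'
  rw [add_zero] at this
  refine this.congr fun r => ?_
  rw [weightedMean, weightedMean, weightedMean, integral_add (hi r) (hi' r), mul_add]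

theorem HasNullMean.const_mul (hu : HasNullMean μ u) {c : ℝ} (hc : 0 ≤ c) :
    HasNullMean μ fun t => c * u t := fun ε hε => by
  obtain ⟨w, hi, hlim, hw⟩ := hu (ε / (c + 1)) (by positivity)
  refine ⟨fun t => c * w t, fun r => (hi r).const_mul c, ?_, fun t => ?_⟩
  · have := hlim.const_mul c
    rw [mul_zero] at this
    refine this.congr fun r => ?_
    rw [weightedMean, weightedMean, integral_const_mul]
    ring
  · have h1 := mul_le_mul_of_nonneg_left (hw t) hc
    have h2 : c * (ε / (c + 1)) ≤ ε := by
      rw [mul_div_assoc', div_le_iff₀ (by positivity)]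
      nlinarith
    linarith

theorem HasNullMean.sum {ι : Type*} (s : Finset ι) {w : ι → ℝ → ℝ}
    (h : ∀ i ∈ s, HasNullMean μ (w i)) : HasNullMean μ fun t => ∑ i ∈ s, w i t := by
  classical
  induction s using Finset.induction_on with
  | empty => simpa using hasNullMean_zero
  | insert i s hi ih =>
    simp only [Finset.sum_insert hi]
    exact (h i (by simp)).add (ih fun j hj => h j (by simp [hj]))

theorem HasNullMean.tendsto (hμ : IsWeight μ) (hu : HasNullMean μ u) (h0 : ∀ t, 0 ≤ u t) :
    Tendsto (weightedMean μ u) atTop (𝓝 0) := by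
  refine Metric.tendsto_nhds.2 fun ε hε => ?_
  obtain ⟨w, hi, hlim, hw⟩ := hu (ε / 2) (half_pos hε)
  filter_upwards [hlim.eventually_lt_const (half_pos hε)] with r hr
  have hfin : IsFiniteMeasure (μ.restrict (Set.Icc (-r) r)) :=
    ⟨by rw [Measure.restrict_apply_univ]; exact hμ.2 _ _⟩
  have hnn : 0 ≤ (μ.real (Set.Icc (-r) r))⁻¹ := inv_nonneg.2 measureReal_nonneg
  have h1 : weightedMean μ u r ≤ ε / 2 + weightedMean μ w r := by
    calc weightedMean μ u r
        ≤ (μ.real (Set.Icc (-r) r))⁻¹ * ∫ t in Set.Icc (-r) r, (ε / 2 + w t) ∂μ := by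
          refine mul_le_mul_of_nonneg_left ?_ hnn
          exact integral_mono_of_nonneg (Eventually.of_forall h0)
            ((integrable_const _).add (hi r)) (Eventually.of_forall hw)
      _ = (μ.real (Set.Icc (-r) r))⁻¹ * μ.real (Set.Icc (-r) r) * (ε / 2)
          + weightedMean μ w r := by
          rw [integral_add (integrable_const _) (hi r), weightedMean]
          simp only [integral_const, measureReal_restrict_apply_univ, smul_eq_mul]
          ring
      _ ≤ ε / 2 + weightedMean μ w r := by
          have : (μ.real (Set.Icc (-r) r))⁻¹ * μ.real (Set.Icc (-r) r) ≤ 1 := inv_mul_le_one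
          nlinarith
  have h2 : 0 ≤ weightedMean μ u r := mul_nonneg hnn (integral_nonneg h0)
  rw [Real.dist_eq, sub_zero, abs_of_nonneg h2]
  linarith

theorem HasNullMean.of_bounded (hμ : IsWeight μ) (hm : Measurable u) {C : ℝ}
    (hC : ∀ t, ‖u t‖ ≤ C) (h : Tendsto (weightedMean μ u) atTop (𝓝 0)) : HasNullMean μ u := by
  refine .of_tendsto (fun r => ?_) h
  have hfin : IsFiniteMeasure (μ.restrict (Set.Icc (-r) r)) :=
    ⟨by rw [Measure.restrict_apply_univ]; exact hμ.2 _ _⟩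
  exact Integrable.of_bound hm.aestronglyMeasurable C (Eventually.of_forall hC)

end NullMean

/-! ### Equicontinuity on compact sets -/

section Deterministic

variable {E F : Type*} [NormedAddCommGroup E] [NormedAddCommGroup F]

/-- Equicontinuity on compact sets controls the increments from a compact set to all nearby points:
adding to the compact set a sequence which approaches it gives a compact set. -/
theorem exists_delta_near_compact {f : ℝ → E → F}
    (hf : ∀ ε : ℝ, 0 < ε → ∀ K : Set E, IsCompact K → ∃ η : ℝ, 0 < η ∧
      ∀ x ∈ K, ∀ y ∈ K, ‖x - y‖ ≤ η → ∀ t, ‖f t x - f t y‖ ≤ ε)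
    {K : Set E} (hK : IsCompact K) {ε : ℝ} (hε : 0 < ε) :
    ∃ η : ℝ, 0 < η ∧ ∀ x, ∀ y ∈ K, ‖x - y‖ ≤ η → ∀ t, ‖f t x - f t y‖ ≤ ε := by
  by_contra hcon
  push Not at hcon
  choose x y hy hxy t hbad using fun n : ℕ =>
    hcon (1 / ((n : ℝ) + 1)) Nat.one_div_pos_of_nat
  obtain ⟨z, -, φ, hφ, hlim⟩ := hK.tendsto_subseq hy
  have hd : Tendsto (fun n => x (φ n) - y (φ n)) atTop (𝓝 0) :=
    squeeze_zero_norm (fun n => hxy (φ n))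
      ((tendsto_one_div_add_atTop_nhds_zero_nat (𝕜 := ℝ)).comp hφ.tendsto_atTop)
  have hlim' : Tendsto (fun n => x (φ n)) atTop (𝓝 z) := by
    simpa using hd.add hlim
  obtain ⟨η, hη, h⟩ := hf ε hε _ (hlim'.isCompact_insert_range.union hlim.isCompact_insert_range)
  obtain ⟨n, hn⟩ := ((tendsto_zero_iff_norm_tendsto_zero.1 hd).eventually_le_const hη).exists
  exact absurd (h (x (φ n)) (Or.inl (by simp)) (y (φ n)) (Or.inr (by simp)) hn (t (φ n)))
    (not_le.2 (hbad _))

/-- On a compact set `f - g` is dominated, up to `ε`, by its values at finitely many points. -/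
theorem exists_finset_norm_le_add_sum {f g h : ℝ → E → F} (hfgh : ∀ t x, f t x = g t x + h t x)
    (hf : ∀ ε : ℝ, 0 < ε → ∀ K : Set E, IsCompact K → ∃ η : ℝ, 0 < η ∧
      ∀ x ∈ K, ∀ y ∈ K, ‖x - y‖ ≤ η → ∀ t, ‖f t x - f t y‖ ≤ ε)
    (hg : UniformlyContinuousOnStrips g) {K : Set E} (hK : IsCompact K) {ε : ℝ} (hε : 0 < ε) :
    ∃ s : Finset E, ∀ t, ∀ y ∈ K, ‖h t y‖ ≤ ε + ∑ x ∈ s, ‖h t x‖ := by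
  obtain ⟨η, hη, h1⟩ := hf (ε / 2) (half_pos hε) K hK
  obtain ⟨δ, hδ, h2⟩ := hg.exists_delta hK (half_pos hε)
  obtain ⟨T, hTK, hT, hcov⟩ := hK.finite_cover_balls (lt_min hη hδ)
  refine ⟨hT.toFinset, fun t y hy => ?_⟩
  obtain ⟨x, hx, hyx⟩ := Set.mem_iUnion₂.1 (hcov hy)
  rw [Metric.mem_ball] at hyx
  have e1 := h1 y hy x (hTK hx) (by
    rw [← dist_eq_norm]; exact (hyx.trans_le (min_le_left _ _)).le) t
  have e2 := h2 t t y hy x (hTK hx) (by simpa using hδ) (hyx.trans_le (min_le_right _ _))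
  rw [dist_eq_norm] at e2
  have e3 : h t y = (f t y - f t x) - (g t y - g t x) + h t x := by
    rw [hfgh, hfgh]; abel
  have e4 : ‖h t x‖ ≤ ∑ x ∈ hT.toFinset, ‖h t x‖ :=
    Finset.single_le_sum (f := fun x => ‖h t x‖) (fun _ _ => norm_nonneg _) (by simpa using hx)
  have e5 : ‖h t y‖ ≤ ‖f t y - f t x‖ + ‖g t y - g t x‖ + ‖h t x‖ := by
    rw [e3]
    exact (norm_add_le _ _).trans (add_le_add_left (norm_sub_le _ _) _)
  linarith

end Deterministic

/-! ### Uniform integrability -/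

section UniformIntegrability

variable {Ω ι : Type*} [MeasurableSpace Ω] {P : Measure Ω}

theorem rpow_add_le_two_rpow_mul {a b p : ℝ} (ha : 0 ≤ a) (hb : 0 ≤ b) (hp : 0 < p) :
    (a + b) ^ p ≤ 2 ^ p * (a ^ p + b ^ p) := by
  have h : (a + b) ^ p ≤ (2 * max a b) ^ p :=
    Real.rpow_le_rpow (by positivity) (by linarith [le_max_left a b, le_max_right a b]) hp.le
  refine h.trans ?_
  rw [Real.mul_rpow zero_le_two (by positivity)]
  refine mul_le_mul_of_nonneg_left ?_ (by positivity)
  rcases max_choice a b with h | h <;> rw [h] <;>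
    linarith [Real.rpow_nonneg ha p, Real.rpow_nonneg hb p]

/-- Uniform integrability is inherited by families which grow at most affinely. -/
theorem uniformIntegrable_of_abs_le_affine [IsProbabilityMeasure P] {u v : ι → Ω → ℝ}
    (hu : UniformIntegrable u 1 P)
    (hv : ∀ i, AEStronglyMeasurable (v i) P) {c : ℝ}
    (h : ∀ i ω, |v i ω| ≤ c * (1 + |u i ω|)) : UniformIntegrable v 1 P := by
  obtain ⟨hum, hui, C, hC⟩ := hu
  have hc1 : c ≤ max c 1 := le_max_left _ _
  have hcpos : 0 < max c 1 := lt_max_of_lt_right one_pos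
  set c' := max c 1
  let w : ι → Ω → ℝ := (fun _ _ => 1) + fun i ω => |u i ω|
  have hua : UnifIntegrable (fun i ω => |u i ω|) 1 P := fun ε hε => by
    obtain ⟨δ, hδ, h⟩ := hui hε
    refine ⟨δ, hδ, fun i s hs hPs => (eLpNorm_mono fun ω => ?_).trans (h i s hs hPs)⟩
    by_cases hω : ω ∈ s <;> simp [hω]
  have hw : UnifIntegrable w 1 P :=
    (unifIntegrable_const le_rfl ENNReal.one_ne_top (memLp_const 1)).add hua le_rfl
      (fun i => aestronglyMeasurable_const) (fun i => (hum i).norm)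
  have hvw : ∀ i ω, ‖v i ω‖ ≤ c' * ‖w i ω‖ := fun i ω => by
    have h0 : 0 ≤ 1 + |u i ω| := by positivity
    simp only [w, Pi.add_apply, Real.norm_eq_abs, abs_of_nonneg h0]
    exact (h i ω).trans (mul_le_mul_of_nonneg_right hc1 h0)
  refine ⟨hv, fun ε hε => ?_, ?_⟩
  · obtain ⟨δ, hδ, h⟩ := hw (div_pos hε hcpos)
    refine ⟨δ, hδ, fun i s hs hPs => ?_⟩
    refine (eLpNorm_le_mul_eLpNorm_of_ae_le_mul (g := s.indicator (w i)) (c := c')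
      (Eventually.of_forall fun ω => ?_) 1).trans ?_
    · by_cases hω : ω ∈ s
      · simpa [hω] using hvw i ω
      · simp [hω]
    · refine (mul_le_mul_right (h i s hs hPs) _).trans ?_
      rw [← ENNReal.ofReal_mul hcpos.le, mul_div_cancel₀ _ hcpos.ne']
  · refine ⟨(ENNReal.ofReal c' * (1 + C)).toNNReal, fun i => ?_⟩
    rw [ENNReal.coe_toNNReal (by finiteness)]
    refine (eLpNorm_le_mul_eLpNorm_of_ae_le_mul (g := w i) (c := c')
      (Eventually.of_forall fun ω => hvw i ω) 1).trans ?_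
    refine mul_le_mul_right ?_ _
    refine (eLpNorm_add_le aestronglyMeasurable_const (hum i).norm le_rfl).trans ?_
    refine add_le_add ?_ ((eLpNorm_norm (u i)).trans_le (hC i))
    exact (eLpNorm_const (1 : ℝ) one_ne_zero (NeZero.ne P)).le.trans (by simp)

/-- Vitali's theorem along a parameter. -/
theorem tendsto_integral_abs_sub_of_uniformIntegrable [IsProbabilityMeasure P] {u : ℝ → Ω → ℝ}
    (hu : UniformIntegrable u 1 P) (hc : ∀ ω, Continuous fun t => u t ω) (t : ℝ) :
    Tendsto (fun s => ∫ ω, |u s ω - u t ω| ∂P) (𝓝 t) (𝓝 0) := by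
  refine tendsto_of_seq_tendsto fun s hs => ?_
  have h1 : UnifIntegrable (fun n => u (s n)) 1 P := fun ε hε => by
    obtain ⟨δ, hδ, h⟩ := hu.2.1 hε
    exact ⟨δ, hδ, fun n => h (s n)⟩
  have h2 := tendsto_Lp_finite_of_tendsto_ae le_rfl ENNReal.one_ne_top (fun n => hu.1 (s n))
    (hu.memLp t) h1 (Eventually.of_forall fun ω => ((hc ω).tendsto t).comp hs)
  have h3 := (ENNReal.tendsto_toReal ENNReal.zero_ne_top).comp h2
  refine h3.congr fun n => ?_
  have hi : Integrable (u (s n) - u t) P := memLp_one_iff_integrable.1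
    ((hu.memLp (s n)).sub (hu.memLp t))
  rw [Function.comp_apply, eLpNorm_one_eq_lintegral_enorm]
  rw [← integral_norm_eq_lintegral_enorm hi.1]
  rfl

/-- Dominated convergence with a dominating function `A s + B` where `A s` tends to `0` in mean. -/
theorem tendsto_integral_of_le_add {D A : ℝ → Ω → ℝ} {B : Ω → ℝ} {t : ℝ}
    (hDm : ∀ s, AEStronglyMeasurable (D s) P) (hD0 : ∀ s ω, 0 ≤ D s ω)
    (hD : ∀ ω, Tendsto (fun s => D s ω) (𝓝 t) (𝓝 0)) (hAi : ∀ s, Integrable (A s) P)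
    (hA0 : ∀ s ω, 0 ≤ A s ω) (hA : Tendsto (fun s => ∫ ω, A s ω ∂P) (𝓝 t) (𝓝 0))
    (hBi : Integrable B P) (hB0 : ∀ ω, 0 ≤ B ω) (h : ∀ s ω, D s ω ≤ A s ω + B ω) :
    Tendsto (fun s => ∫ ω, D s ω ∂P) (𝓝 t) (𝓝 0) := by
  have hmin : ∀ s, Integrable (fun ω => min (D s ω) (B ω)) P := fun s =>
    hBi.mono' ((hDm s).inf hBi.1) (Eventually.of_forall fun ω => by
      rw [Real.norm_of_nonneg (le_min (hD0 s ω) (hB0 ω))]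
      exact min_le_right _ _)
  have h1 : Tendsto (fun s => ∫ ω, min (D s ω) (B ω) ∂P) (𝓝 t) (𝓝 (∫ _, (0 : ℝ) ∂P)) := by
    refine tendsto_integral_filter_of_dominated_convergence B
      (Eventually.of_forall fun s => (hmin s).1) ?_ hBi ?_
    · refine Eventually.of_forall fun s => Eventually.of_forall fun ω => ?_
      rw [Real.norm_of_nonneg (le_min (hD0 s ω) (hB0 ω))]
      exact min_le_right _ _
    · refine Eventually.of_forall fun ω => ?_
      exact squeeze_zero (fun s => le_min (hD0 s ω) (hB0 ω)) (fun s => min_le_left _ _) (hD ω)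
  have h2 := hA.add h1
  simp only [integral_zero, add_zero] at h2
  refine squeeze_zero (fun s => integral_nonneg (hD0 s)) (fun s => ?_) h2
  rw [← integral_add (hAi s) (hmin s)]
  refine integral_mono_of_nonneg (Eventually.of_forall (hD0 s)) ((hAi s).add (hmin s))
    (Eventually.of_forall fun ω => ?_)
  rcases le_total (D s ω) (B ω) with h' | h'
  · simp only [min_eq_left h']
    linarith [hA0 s ω]
  · simp only [min_eq_right h']
    exact h s ω

end UniformIntegrability

/-! ### The size of a random vector in `L^p` -/

section LpSize

variable {Ω E F : Type*} [MeasurableSpace Ω] [NormedAddCommGroup E] [NormedAddCommGroup F]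
  {P : Measure Ω} {p : ℝ}

theorem lpSize_zero (U : Ω → E) : lpSize P 0 U = ∫ ω, min ‖U ω‖ 1 ∂P := if_pos rfl

theorem lpSize_of_pos (hp : 0 < p) (U : Ω → E) :
    lpSize P p U = (∫ ω, ‖U ω‖ ^ p ∂P) ^ (1 / p) := if_neg hp.ne'

theorem lpSize_nonneg (U : Ω → E) : 0 ≤ lpSize P p U := by
  unfold lpSize
  split_ifs
  · exact integral_nonneg fun ω => le_min (norm_nonneg _) zero_le_one
  · exact Real.rpow_nonneg (integral_nonneg fun ω => Real.rpow_nonneg (norm_nonneg _) _) _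

theorem memLp_ofReal_iff_integrable_norm_rpow (hp : 0 < p) {U : Ω → E}
    (hU : AEStronglyMeasurable U P) :
    MemLp U (ENNReal.ofReal p) P ↔ Integrable (fun ω => ‖U ω‖ ^ p) P := by
  rw [← integrable_norm_rpow_iff hU (by simpa using hp) ENNReal.ofReal_ne_top,
    ENNReal.toReal_ofReal hp.le]

theorem lpSize_le_mul (hp : 0 < p) {U : Ω → F} {V : Ω → E} {L : ℝ} (hL : 0 ≤ L)
    (hV : Integrable (fun ω => ‖V ω‖ ^ p) P) (h : ∀ ω, ‖U ω‖ ≤ L * ‖V ω‖) :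
    lpSize P p U ≤ L * lpSize P p V := by
  rw [lpSize_of_pos hp, lpSize_of_pos hp]
  have h1 : ∫ ω, ‖U ω‖ ^ p ∂P ≤ L ^ p * ∫ ω, ‖V ω‖ ^ p ∂P := by
    rw [← integral_const_mul]
    refine integral_mono_of_nonneg (Eventually.of_forall fun ω => by positivity)
      (hV.const_mul _) (Eventually.of_forall fun ω => ?_)
    simp only
    rw [← Real.mul_rpow hL (norm_nonneg _)]
    exact Real.rpow_le_rpow (norm_nonneg _) (h ω) hp.le
  have hn : 0 ≤ ∫ ω, ‖V ω‖ ^ p ∂P := integral_nonneg fun ω => by positivity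
  calc _ ≤ (L ^ p * ∫ ω, ‖V ω‖ ^ p ∂P) ^ (1 / p) :=
        Real.rpow_le_rpow (integral_nonneg fun ω => by positivity) h1 (by positivity)
    _ = L * (∫ ω, ‖V ω‖ ^ p ∂P) ^ (1 / p) := by
        rw [Real.mul_rpow (by positivity) hn, ← Real.rpow_mul hL, mul_one_div_cancel hp.ne',
          Real.rpow_one]

/-- Quasi-triangle inequality, valid for all `p > 0`. -/
theorem lpSize_add_le (hp : 0 < p) {U V : Ω → E} (hU : Integrable (fun ω => ‖U ω‖ ^ p) P)
    (hV : Integrable (fun ω => ‖V ω‖ ^ p) P) :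
    lpSize P p (fun ω => U ω + V ω) ≤ 2 * 2 ^ (1 / p) * (lpSize P p U + lpSize P p V) := by
  rw [lpSize_of_pos hp, lpSize_of_pos hp, lpSize_of_pos hp]
  have hUn : 0 ≤ ∫ ω, ‖U ω‖ ^ p ∂P := integral_nonneg fun ω => by positivity
  have hVn : 0 ≤ ∫ ω, ‖V ω‖ ^ p ∂P := integral_nonneg fun ω => by positivity
  have h1 : ∫ ω, ‖U ω + V ω‖ ^ p ∂P ≤ 2 ^ p * (∫ ω, ‖U ω‖ ^ p ∂P + ∫ ω, ‖V ω‖ ^ p ∂P) := by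
    rw [← integral_add hU hV, ← integral_const_mul]
    refine integral_mono_of_nonneg (Eventually.of_forall fun ω => by positivity)
      ((hU.add hV).const_mul _) (Eventually.of_forall fun ω => ?_)
    exact (Real.rpow_le_rpow (norm_nonneg _) (norm_add_le _ _) hp.le).trans
      (rpow_add_le_two_rpow_mul (norm_nonneg _) (norm_nonneg _) hp)
  calc _ ≤ (2 ^ p * (∫ ω, ‖U ω‖ ^ p ∂P + ∫ ω, ‖V ω‖ ^ p ∂P)) ^ (1 / p) :=
        Real.rpow_le_rpow (integral_nonneg fun ω => by positivity) h1 (by positivity)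
    _ = 2 * (∫ ω, ‖U ω‖ ^ p ∂P + ∫ ω, ‖V ω‖ ^ p ∂P) ^ (1 / p) := by
        rw [Real.mul_rpow (by positivity) (by positivity), ← Real.rpow_mul zero_le_two,
          mul_one_div_cancel hp.ne', Real.rpow_one]
    _ ≤ 2 * (2 ^ (1 / p) * ((∫ ω, ‖U ω‖ ^ p ∂P) ^ (1 / p) + (∫ ω, ‖V ω‖ ^ p ∂P) ^ (1 / p))) := by
        refine mul_le_mul_of_nonneg_left ?_ zero_le_two
        exact rpow_add_le_two_rpow_mul hUn hVn (by positivity)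
    _ = _ := by ring

theorem tendsto_lpSize_zero_iff (hp : 0 < p) {ι : Type*} {l : Filter ι} {U : ι → Ω → E} :
    Tendsto (fun i => lpSize P p (U i)) l (𝓝 0) ↔
      Tendsto (fun i => ∫ ω, ‖U i ω‖ ^ p ∂P) l (𝓝 0) := by
  simp only [lpSize_of_pos hp]
  constructor <;> intro h
  · have := h.rpow_const (p := p) (Or.inr hp.le)
    rw [Real.zero_rpow hp.ne'] at this
    refine this.congr fun i => ?_
    rw [← Real.rpow_mul (integral_nonneg fun ω => by positivity), one_div_mul_cancel hp.ne',
      Real.rpow_one]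
  · have := h.rpow_const (p := 1 / p) (Or.inr (by positivity))
    rwa [Real.zero_rpow (by positivity)] at this

theorem IsContinuousProcess.measurable_lpSize [SFinite P] [MeasurableSpace E]
    [BorelSpace E] {Z : ℝ → Ω → E} (hZ : IsContinuousProcess Z)
    (p : ℝ) : Measurable fun t => lpSize P p (Z t) := by
  have hm : Measurable (Function.uncurry Z) :=
    measurable_uncurry_of_continuous_of_measurable hZ.2 hZ.1
  unfold lpSize
  split_ifs
  · have : StronglyMeasurable (Function.uncurry fun t ω => min ‖Z t ω‖ 1) :=
      (hm.norm.min measurable_const).stronglyMeasurable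
    exact this.integral_prod_right.measurable
  · have : StronglyMeasurable (Function.uncurry fun t ω => ‖Z t ω‖ ^ p) :=
      (hm.norm.pow_const p).stronglyMeasurable
    exact this.integral_prod_right.measurable.pow_const _

theorem integrable_min_norm_one [IsFiniteMeasure P] [MeasurableSpace E] [BorelSpace E]
    {U : Ω → E} (hU : Measurable U) :
    Integrable (fun ω => min ‖U ω‖ 1) P :=
  integrable_of_abs_le_one P (hU.norm.min measurable_const) fun ω => by
    rw [abs_of_nonneg (le_min (norm_nonneg _) zero_le_one)]
    exact min_le_right _ _

theorem lpSize_zero_le_one [IsProbabilityMeasure P] (U : Ω → E) : lpSize P 0 U ≤ 1 := by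
  rw [lpSize_zero]
  exact (le_abs_self _).trans (abs_integral_le_one P fun ω => by
    rw [abs_of_nonneg (le_min (norm_nonneg _) zero_le_one)]
    exact min_le_right _ _)

theorem ErgodicProcess.hasNullMean [SFinite P] [MeasurableSpace E] [BorelSpace E]
    {μ : Measure ℝ} {Z : ℝ → Ω → E} (hZ : ErgodicProcess P μ p Z)
    (hμ : IsWeight μ) (hZc : IsContinuousProcess Z) : HasNullMean μ fun t => lpSize P p (Z t) := by
  obtain ⟨-, -, ⟨C, hC⟩, hlim⟩ := hZ
  refine .of_bounded hμ (hZc.measurable_lpSize p) (C := C) (fun t => ?_) hlim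
  rw [Real.norm_of_nonneg (lpSize_nonneg _)]
  exact hC t

/-- Bound on the size in `L⁰` by splitting `Ω` according to an event of small probability. -/
theorem lpSize_zero_le_of_le_on [IsProbabilityMeasure P] [MeasurableSpace E] [BorelSpace E]
    {U : Ω → F} {V : Ω → E} (hV : Measurable V) {B : Set Ω}
    (hB : MeasurableSet B) {a b ε : ℝ} (hPB : P.real B ≤ ε)
    (hB1 : ∀ ω ∈ B, 1 ≤ a + b * min ‖V ω‖ 1 + 1)
    (h : ∀ ω ∉ B, min ‖U ω‖ 1 ≤ a + b * min ‖V ω‖ 1) :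
    lpSize P 0 U ≤ a + b * lpSize P 0 V + ε := by
  simp only [lpSize_zero]
  have hi : Integrable (B.indicator fun _ => (1 : ℝ)) P := (integrable_const _).indicator hB
  have hV' := (integrable_min_norm_one (P := P) hV).const_mul b
  calc ∫ ω, min ‖U ω‖ 1 ∂P
      ≤ ∫ ω, (a + b * min ‖V ω‖ 1 + B.indicator (fun _ => (1 : ℝ)) ω) ∂P := by
        refine integral_mono_of_nonneg
          (Eventually.of_forall fun ω => le_min (norm_nonneg _) zero_le_one)
          (((integrable_const a).add hV').add hi) (Eventually.of_forall fun ω => ?_)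
        by_cases hω : ω ∈ B
        · simpa [hω] using (min_le_right _ _).trans (hB1 ω hω)
        · simpa [hω] using h ω hω
    _ = a + b * ∫ ω, min ‖V ω‖ 1 ∂P + P.real B := by
        have haV : Integrable (fun ω => a + b * min ‖V ω‖ 1) P := (integrable_const a).add hV'
        rw [integral_add haV hi, integral_add (integrable_const a) hV',
          integral_const_mul, integral_indicator_const _ hB]
        simp
    _ ≤ _ := by linarith

theorem ErgodicUniformlyOnCompacts.hasNullMean_sum {μ : Measure ℝ} {h : ℝ → E → F} (hμ : IsWeight μ)
    (hh : ErgodicUniformlyOnCompacts μ h) (s : Finset E) :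
    HasNullMean μ fun t => ∑ x ∈ s, ‖h t x‖ := by
  refine HasNullMean.sum s fun x _ => ?_
  obtain ⟨hc, ⟨C, hC⟩, hlim⟩ := hh.2.1 x
  exact .of_bounded hμ hc.norm.measurable (C := C) (fun t => by simpa using hC t) hlim

end LpSize

/-! ### Ergodic processes -/

section Processes

variable {Ω E F : Type*} [MeasurableSpace Ω]
  [NormedAddCommGroup E] [MeasurableSpace E] [BorelSpace E]
  [NormedAddCommGroup F] [SecondCountableTopology F] [MeasurableSpace F] [BorelSpace F]
  {P : Measure Ω} [IsProbabilityMeasure P] {μ : Measure ℝ} {p : ℝ}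

theorem IsContinuousProcess.add [SecondCountableTopology E] {U V : ℝ → Ω → E}
    (hU : IsContinuousProcess U) (hV : IsContinuousProcess V) :
    IsContinuousProcess fun t ω => U t ω + V t ω :=
  ⟨fun t => (hU.1 t).add (hV.1 t), fun ω => (hU.2 ω).add (hV.2 ω)⟩

theorem IsContinuousProcess.sub [SecondCountableTopology E] {U V : ℝ → Ω → E}
    (hU : IsContinuousProcess U) (hV : IsContinuousProcess V) :
    IsContinuousProcess fun t ω => U t ω - V t ω :=
  ⟨fun t => (hU.1 t).sub (hV.1 t), fun ω => (hU.2 ω).sub (hV.2 ω)⟩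

/-- Stability of `μ`-ergodicity in `L^p`, `p > 0`: the sum of a process dominated by an ergodic
process and of a process of small mean size whose `p`-th powers are uniformly integrable. -/
theorem ErgodicProcess.of_dominated_add (hp : 0 < p) (hμ : IsWeight μ) {Z : ℝ → Ω → E}
    {V W : ℝ → Ω → F} (hZ : ErgodicProcess P μ p Z) (hZc : IsContinuousProcess Z)
    (hVc : IsContinuousProcess V) (hWc : IsContinuousProcess W) {L : ℝ} (hL : 0 ≤ L)
    (hV : ∀ t ω, ‖V t ω‖ ≤ L * ‖Z t ω‖)
    (hWu : UniformIntegrable (fun t ω => ‖W t ω‖ ^ p) 1 P)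
    (hWn : HasNullMean μ fun t => lpSize P p (W t)) :
    ErgodicProcess P μ p fun t ω => V t ω + W t ω := by
  have hZn := hZ.hasNullMean hμ hZc
  obtain ⟨hZm, hZt, ⟨C, hC⟩, -⟩ := hZ
  have hUc := hVc.add hWc
  have hZi : ∀ t, Integrable (fun ω => ‖Z t ω‖ ^ p) P := fun t =>
    (memLp_ofReal_iff_integrable_norm_rpow hp (hZm t).1).1 (hZm t)
  have hVZ : ∀ t ω, ‖V t ω‖ ^ p ≤ L ^ p * ‖Z t ω‖ ^ p := fun t ω => by
    rw [← Real.mul_rpow hL (norm_nonneg _)]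
    exact Real.rpow_le_rpow (norm_nonneg _) (hV t ω) hp.le
  have hVi : ∀ t, Integrable (fun ω => ‖V t ω‖ ^ p) P := fun t =>
    ((hZi t).const_mul (L ^ p)).mono' ((hVc.1 t).norm.pow_const p).aestronglyMeasurable
      (Eventually.of_forall fun ω => by
        rw [Real.norm_of_nonneg (by positivity)]
        exact hVZ t ω)
  have hWi : ∀ t, Integrable (fun ω => ‖W t ω‖ ^ p) P := fun t =>
    memLp_one_iff_integrable.1 (hWu.memLp t)
  have hVm : ∀ t, MemLp (V t) (ENNReal.ofReal p) P := fun t =>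
    (memLp_ofReal_iff_integrable_norm_rpow hp (hVc.1 t).aestronglyMeasurable).2 (hVi t)
  have hWm : ∀ t, MemLp (W t) (ENNReal.ofReal p) P := fun t =>
    (memLp_ofReal_iff_integrable_norm_rpow hp (hWc.1 t).aestronglyMeasurable).2 (hWi t)
  have hUm : ∀ t, MemLp (fun ω => V t ω + W t ω) (ENNReal.ofReal p) P := fun t =>
    (hVm t).add (hWm t)
  have hUi : ∀ t, Integrable (fun ω => ‖V t ω + W t ω‖ ^ p) P := fun t =>
    (memLp_ofReal_iff_integrable_norm_rpow hp (hUm t).1).1 (hUm t)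
  have hle : ∀ t, lpSize P p (fun ω => V t ω + W t ω) ≤
      2 * 2 ^ (1 / p) * (L * lpSize P p (Z t) + lpSize P p (W t)) := fun t =>
    (lpSize_add_le hp (hVi t) (hWi t)).trans (mul_le_mul_of_nonneg_left
      (add_le_add_left (lpSize_le_mul hp hL (hZi t) (hV t)) _) (by positivity))
  refine ⟨hUm, fun t => ?_, ?_, ?_⟩
  · rw [tendsto_lpSize_zero_iff hp]
    have ht := (tendsto_lpSize_zero_iff hp).1 (hZt t)
    have hW := tendsto_integral_abs_sub_of_uniformIntegrable hWu
      (fun ω => ((hWc.2 ω).norm.rpow_const fun _ => Or.inr hp.le)) t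
    have hZd : ∀ s, Integrable (fun ω => ‖Z s ω - Z t ω‖ ^ p) P := fun s =>
      (memLp_ofReal_iff_integrable_norm_rpow hp ((hZm s).sub (hZm t)).1).1 ((hZm s).sub (hZm t))
    have hWd : ∀ s, Integrable (fun ω => |‖W s ω‖ ^ p - ‖W t ω‖ ^ p|) P := fun s =>
      ((hWi s).sub (hWi t)).abs
    set a : ℝ := 2 ^ p with ha
    have ha0 : 0 ≤ a := by positivity
    have hL0 : 0 ≤ L ^ p := by positivity
    -- The increments of `V` are bounded through `Z`, which is continuous in `L^p`, those of `W`
    -- through the continuity of `‖W‖ ^ p` in `L¹`.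
    refine tendsto_integral_of_le_add (P := P)
      (A := fun s ω => a * (a * (L ^ p * (a * ‖Z s ω - Z t ω‖ ^ p) +
        |‖W s ω‖ ^ p - ‖W t ω‖ ^ p|)))
      (B := fun ω => a * (a * (L ^ p * (a * ‖Z t ω‖ ^ p) + ‖W t ω‖ ^ p) +
        ‖V t ω + W t ω‖ ^ p)) (fun s => ?_) (fun s ω => by positivity) (fun ω => ?_) (fun s => ?_)
      (fun s ω => by positivity) ?_ ?_ (fun ω => by positivity) (fun s ω => ?_)
    · exact (((hUc.1 s).sub (hUc.1 t)).norm.pow_const p).aestronglyMeasurable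
    · have h1 : Continuous fun s => ‖(V s ω + W s ω) - (V t ω + W t ω)‖ ^ p :=
        ((hUc.2 ω).sub continuous_const).norm.rpow_const fun _ => Or.inr hp.le
      simpa [Real.zero_rpow hp.ne'] using h1.tendsto t
    · exact ((((hZd s).const_mul a).const_mul (L ^ p)).add (hWd s)).const_mul a |>.const_mul a
    · have h1 := (((ht.const_mul a).const_mul (L ^ p)).add hW).const_mul a |>.const_mul a
      simp only [mul_zero, add_zero] at h1
      refine h1.congr fun s => ?_
      rw [integral_const_mul, integral_const_mul,
        integral_add (((hZd s).const_mul a).const_mul (L ^ p)) (hWd s), integral_const_mul,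
        integral_const_mul]
    · exact ((((((hZi t).const_mul a).const_mul (L ^ p)).add (hWi t)).const_mul a).add
        (hUi t)).const_mul a
    · have e1 : ‖(V s ω + W s ω) - (V t ω + W t ω)‖ ^ p ≤
          a * (‖V s ω + W s ω‖ ^ p + ‖V t ω + W t ω‖ ^ p) :=
        (Real.rpow_le_rpow (norm_nonneg _) (norm_sub_le _ _) hp.le).trans
          (rpow_add_le_two_rpow_mul (norm_nonneg _) (norm_nonneg _) hp)
      have e2 : ‖V s ω + W s ω‖ ^ p ≤ a * (‖V s ω‖ ^ p + ‖W s ω‖ ^ p) :=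
        (Real.rpow_le_rpow (norm_nonneg _) (norm_add_le _ _) hp.le).trans
          (rpow_add_le_two_rpow_mul (norm_nonneg _) (norm_nonneg _) hp)
      have e3 : ‖Z s ω‖ ^ p ≤ a * (‖Z s ω - Z t ω‖ ^ p + ‖Z t ω‖ ^ p) := by
        refine le_trans (Real.rpow_le_rpow (norm_nonneg _) ?_ hp.le)
          (rpow_add_le_two_rpow_mul (norm_nonneg _) (norm_nonneg _) hp)
        simpa using norm_add_le (Z s ω - Z t ω) (Z t ω)
      have e4 : ‖W s ω‖ ^ p ≤ |‖W s ω‖ ^ p - ‖W t ω‖ ^ p| + ‖W t ω‖ ^ p := by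
        linarith [le_abs_self (‖W s ω‖ ^ p - ‖W t ω‖ ^ p)]
      have e5 := mul_le_mul_of_nonneg_left e3 hL0
      have e6 : ‖V s ω‖ ^ p + ‖W s ω‖ ^ p ≤ L ^ p * (a * (‖Z s ω - Z t ω‖ ^ p + ‖Z t ω‖ ^ p)) +
          (|‖W s ω‖ ^ p - ‖W t ω‖ ^ p| + ‖W t ω‖ ^ p) := by linarith [hVZ s ω]
      have e7 := mul_le_mul_of_nonneg_left (e2.trans (mul_le_mul_of_nonneg_left e6 ha0)) ha0
      refine e1.trans ?_
      rw [mul_add]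
      refine (add_le_add_left e7 _).trans_eq ?_
      ring
  · obtain ⟨M, hM⟩ := hWu.2.2
    refine ⟨2 * 2 ^ (1 / p) * (L * C + (M : ℝ) ^ (1 / p)), fun t => (hle t).trans ?_⟩
    refine mul_le_mul_of_nonneg_left (add_le_add (mul_le_mul_of_nonneg_left (hC t) hL) ?_)
      (by positivity)
    rw [lpSize_of_pos hp]
    refine Real.rpow_le_rpow (integral_nonneg fun ω => by positivity) ?_ (by positivity)
    have h1 := hM t
    rw [eLpNorm_one_eq_lintegral_enorm, ← ofReal_integral_norm_eq_lintegral_enorm (hWi t)] at h1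
    have h2 := (ENNReal.ofReal_le_iff_le_toReal ENNReal.coe_ne_top).1 h1
    refine le_trans (integral_mono (hWi t) (hWi t).norm fun ω => le_abs_self _) h2
  · exact (((hZn.const_mul hL).add hWn).const_mul (c := 2 * 2 ^ (1 / p)) (by positivity)).mono hle
      |>.tendsto hμ fun t => lpSize_nonneg _

/-- For `p = 0` only the vanishing of the mean has to be checked: a continuous process is
continuous in probability. -/
theorem IsContinuousProcess.ergodicProcess_zero [SecondCountableTopology E] {U : ℝ → Ω → E}
    (hU : IsContinuousProcess U)
    (hμ : IsWeight μ) (h : HasNullMean μ fun t => lpSize P 0 (U t)) : ErgodicProcess P μ 0 U := by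
  refine ⟨fun t => ?_, fun t => ?_, ⟨1, fun t => lpSize_zero_le_one _⟩,
    h.tendsto hμ fun t => lpSize_nonneg _⟩
  · rw [ENNReal.ofReal_zero, memLp_zero_iff_aestronglyMeasurable]
    exact (hU.1 t).aestronglyMeasurable
  · simp only [lpSize_zero]
    have : Tendsto (fun s => ∫ ω, min ‖U s ω - U t ω‖ 1 ∂P) (𝓝 t) (𝓝 (∫ _, (0 : ℝ) ∂P)) := by
      refine tendsto_integral_filter_of_dominated_convergence (fun _ => (1 : ℝ))
        (Eventually.of_forall fun s => (integrable_min_norm_one ((hU.1 s).sub (hU.1 t))).1) ?_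
        (integrable_const _) ?_
      · refine Eventually.of_forall fun s => Eventually.of_forall fun ω => ?_
        rw [Real.norm_of_nonneg (le_min (norm_nonneg _) zero_le_one)]
        exact min_le_right _ _
      · refine Eventually.of_forall fun ω => ?_
        have h1 : Continuous fun s => min ‖U s ω - U t ω‖ 1 :=
          ((hU.2 ω).sub continuous_const).norm.min continuous_const
        simpa using h1.tendsto t
    simpa using this

theorem lpSize_zero_add_le [SecondCountableTopology E] {U V : Ω → E}
    (hU : Measurable U) (hV : Measurable V) :
    lpSize P 0 (fun ω => U ω + V ω) ≤ lpSize P 0 U + lpSize P 0 V := by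
  simp only [lpSize_zero]
  rw [← integral_add (integrable_min_norm_one hU) (integrable_min_norm_one hV)]
  refine integral_mono (integrable_min_norm_one (hU.add hV))
    ((integrable_min_norm_one hU).add (integrable_min_norm_one hV)) fun ω => ?_
  have h1 := norm_add_le (U ω) (V ω)
  have h2 := norm_nonneg (U ω)
  have h3 := norm_nonneg (V ω)
  simp only
  rcases le_total ‖U ω‖ 1 with h4 | h4 <;> rcases le_total ‖V ω‖ 1 with h5 | h5 <;>
    simp only [min_eq_left, min_eq_right, h4, h5]
  · exact (min_le_left _ _).trans h1
  all_goals linarith [min_le_right ‖U ω + V ω‖ 1]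

end Processes

/-! ### Pseudo almost automorphy -/

section PseudoAlmostAutomorphy

variable {Ω E F : Type*} [MeasurableSpace Ω]
  [NormedAddCommGroup E] [SecondCountableTopology E] [MeasurableSpace E] [BorelSpace E]
  [NormedAddCommGroup F] {P : Measure Ω} [IsProbabilityMeasure P] {μ : Measure ℝ}

variable {Y : ℝ → Ω → E} {f g h : ℝ → E → F}

theorem AlmostAutomorphicInDistribution.uniformIntegrable_norm_rpow_comp [MeasurableSpace F]
    [BorelSpace F] {p : ℝ} (hp : 0 < p)
    (hY : AlmostAutomorphicInDistribution P Y)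
    (hYu : UniformIntegrable (fun t ω => ‖Y t ω‖ ^ p) 1 P) (hg : Continuous (Function.uncurry g))
    {C : ℝ} (hC : ∀ t x, ‖g t x‖ ≤ C * (1 + ‖x‖)) :
    UniformIntegrable (fun t ω => ‖g t (Y t ω)‖ ^ p) 1 P := by
  obtain ⟨hYc, -⟩ := hY
  have hC0 : 0 ≤ C := by simpa using (norm_nonneg _).trans (hC 0 0)
  refine uniformIntegrable_of_abs_le_affine (c := C ^ p * 2 ^ p) hYu
    (fun t => (((hYc.superposition hg).1 t).norm.pow_const p).aestronglyMeasurable)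
    fun t ω => ?_
  rw [abs_of_nonneg (by positivity), abs_of_nonneg (by positivity)]
  calc ‖g t (Y t ω)‖ ^ p ≤ (C * (1 + ‖Y t ω‖)) ^ p :=
        Real.rpow_le_rpow (norm_nonneg _) (hC t _) hp.le
    _ = C ^ p * (1 + ‖Y t ω‖) ^ p := Real.mul_rpow hC0 (by positivity)
    _ ≤ C ^ p * (2 ^ p * (1 ^ p + ‖Y t ω‖ ^ p)) :=
        mul_le_mul_of_nonneg_left
          (rpow_add_le_two_rpow_mul zero_le_one (norm_nonneg _) hp) (by positivity)
    _ = C ^ p * 2 ^ p * (1 + ‖Y t ω‖ ^ p) := by rw [Real.one_rpow]; ring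

/-- The ergodic part of `f` along an almost automorphic process has null mean in `L⁰`. -/
theorem hasNullMean_lpSize_zero_comp [CompleteSpace E]
    (hY : AlmostAutomorphicInDistribution P Y) (hμ : IsWeight μ)
    (hh : ErgodicUniformlyOnCompacts μ h)
    (hnet : ∀ K : Set E, IsCompact K → ∀ ε > 0, ∃ s : Finset E, ∀ t, ∀ y ∈ K,
      ‖h t y‖ ≤ ε + ∑ x ∈ s, ‖h t x‖) :
    HasNullMean μ fun t => lpSize P 0 fun ω => h t (Y t ω) := by
  refine .of_forall_le fun ε hε => ?_
  obtain ⟨K, hK, hKP⟩ := hY.exists_isCompact (ε := ENNReal.ofReal (ε / 2)) (by simpa using hε)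
  obtain ⟨s, hs⟩ := hnet K hK (ε / 2) (half_pos hε)
  refine ⟨_, hh.hasNullMean_sum hμ s, fun t => ?_⟩
  have hsum : 0 ≤ ∑ x ∈ s, ‖h t x‖ := Finset.sum_nonneg fun _ _ => norm_nonneg _
  have := lpSize_zero_le_of_le_on (P := P) (U := fun ω => h t (Y t ω)) (V := fun _ => (0 : E))
    (B := {ω | Y t ω ∉ K}) (a := ε / 2 + ∑ x ∈ s, ‖h t x‖) (b := 0) (ε := ε / 2) measurable_const
    (hY.1.1 t hK.isClosed.measurableSet).compl
    (ENNReal.toReal_le_of_le_ofReal (by positivity) (hKP t))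
    (fun ω _ => by linarith) (fun ω hω => by
      have := hs t (Y t ω) (not_not.1 hω)
      linarith [min_le_left ‖h t (Y t ω)‖ 1])
  linarith

/-- The ergodic part of `f` along an almost automorphic process has null mean in `L^p`: outside a
compact set it is small by uniform integrability. -/
theorem hasNullMean_lpSize_comp [CompleteSpace E] {p : ℝ} (hp : 0 < p)
    (hY : AlmostAutomorphicInDistribution P Y)
    (hμ : IsWeight μ) (hh : ErgodicUniformlyOnCompacts μ h)
    (hu : UniformIntegrable (fun t ω => ‖h t (Y t ω)‖ ^ p) 1 P)
    (hnet : ∀ K : Set E, IsCompact K → ∀ ε > 0, ∃ s : Finset E, ∀ t, ∀ y ∈ K,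
      ‖h t y‖ ≤ ε + ∑ x ∈ s, ‖h t x‖) :
    HasNullMean μ fun t => lpSize P p fun ω => h t (Y t ω) := by
  refine .of_forall_le fun ε hε => ?_
  set c : ℝ := 2 ^ (1 / p) with hc
  have hc0 : 0 < c := by positivity
  have hε1 : 0 < (ε / (2 * c)) ^ p := by positivity
  obtain ⟨δ, hδ, hsmall⟩ := hu.2.1 hε1
  obtain ⟨K, hK, hKP⟩ := hY.exists_isCompact (ε := ENNReal.ofReal δ) (by simpa using hδ)
  obtain ⟨s, hs⟩ := hnet K hK (ε / (2 * c)) (by positivity)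
  refine ⟨_, (hh.hasNullMean_sum hμ s).const_mul hc0.le, fun t => ?_⟩
  have hsum : 0 ≤ ∑ x ∈ s, ‖h t x‖ := Finset.sum_nonneg fun _ _ => norm_nonneg _
  set w := ε / (2 * c) + ∑ x ∈ s, ‖h t x‖ with hw
  have hw0 : 0 ≤ w := by positivity
  set B : Set Ω := {ω | Y t ω ∉ K}
  have hB : MeasurableSet B := (hY.1.1 t hK.isClosed.measurableSet).compl
  have hi : Integrable (fun ω => ‖h t (Y t ω)‖ ^ p) P := memLp_one_iff_integrable.1 (hu.memLp t)
  have h1 : ∫ ω, B.indicator (fun ω => ‖h t (Y t ω)‖ ^ p) ω ∂P ≤ (ε / (2 * c)) ^ p := by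
    have h2 := hsmall t B hB (hKP t)
    rw [eLpNorm_one_eq_lintegral_enorm,
      ← ofReal_integral_norm_eq_lintegral_enorm (hi.indicator hB),
      ENNReal.ofReal_le_ofReal_iff hε1.le] at h2
    exact (integral_mono (hi.indicator hB) (hi.indicator hB).norm fun ω => le_abs_self _).trans h2
  have h3 : ∫ ω, ‖h t (Y t ω)‖ ^ p ∂P ≤ w ^ p + (ε / (2 * c)) ^ p := by
    calc _ ≤ ∫ ω, (w ^ p + B.indicator (fun ω => ‖h t (Y t ω)‖ ^ p) ω) ∂P := by
          refine integral_mono hi ((integrable_const _).add (hi.indicator hB)) fun ω => ?_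
          by_cases hω : ω ∈ B
          · simp only [Set.indicator_of_mem hω]
            linarith [Real.rpow_nonneg hw0 p]
          · simpa [hω] using Real.rpow_le_rpow (norm_nonneg _) (hs t _ (not_not.1 hω)) hp.le
      _ ≤ _ := by
          rw [integral_add (integrable_const _) (hi.indicator hB)]
          simpa using h1
  have hinv : ∀ x : ℝ, 0 ≤ x → (x ^ p) ^ (1 / p) = x := fun x hx => by
    rw [← Real.rpow_mul hx, mul_one_div_cancel hp.ne', Real.rpow_one]
  calc lpSize P p (fun ω => h t (Y t ω)) = (∫ ω, ‖h t (Y t ω)‖ ^ p ∂P) ^ (1 / p) :=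
        lpSize_of_pos hp _
    _ ≤ (w ^ p + (ε / (2 * c)) ^ p) ^ (1 / p) :=
        Real.rpow_le_rpow (integral_nonneg fun ω => by positivity) h3 (by positivity)
    _ ≤ c * ((w ^ p) ^ (1 / p) + ((ε / (2 * c)) ^ p) ^ (1 / p)) :=
        rpow_add_le_two_rpow_mul (by positivity) (by positivity) (by positivity)
    _ = c * (w + ε / (2 * c)) := by rw [hinv w hw0, hinv _ (by positivity)]
    _ = ε + c * ∑ x ∈ s, ‖h t x‖ := by
        rw [hw]
        field_simp
        ring

/-- The increment of `f` between a pseudo almost automorphic process and its almost automorphic part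
has null mean in `L⁰`. -/
theorem hasNullMean_lpSize_zero_increment [CompleteSpace E] {X Z : ℝ → Ω → E}
    (hY : AlmostAutomorphicInDistribution P Y) (hμ : IsWeight μ) (hZc : IsContinuousProcess Z)
    (hZ : ErgodicProcess P μ 0 Z) (hXYZ : ∀ t ω, X t ω = Y t ω + Z t ω)
    (hf : ∀ ε : ℝ, 0 < ε → ∀ K : Set E, IsCompact K → ∃ η : ℝ, 0 < η ∧
      ∀ x ∈ K, ∀ y ∈ K, ‖x - y‖ ≤ η → ∀ t, ‖f t x - f t y‖ ≤ ε) :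
    HasNullMean μ fun t => lpSize P 0 fun ω => f t (X t ω) - f t (Y t ω) := by
  refine .of_forall_le fun ε hε => ?_
  obtain ⟨K, hK, hKP⟩ := hY.exists_isCompact (ε := ENNReal.ofReal (ε / 2)) (by simpa using hε)
  obtain ⟨η, hη, hinc⟩ := exists_delta_near_compact hf hK (half_pos hε)
  have hη' : 0 < min η 1 := lt_min hη one_pos
  refine ⟨_, (hZ.hasNullMean hμ hZc).const_mul (inv_nonneg.2 hη'.le), fun t => ?_⟩
  have hm0 : ∀ ω, 0 ≤ (min η 1)⁻¹ * min ‖Z t ω‖ 1 := fun ω =>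
    mul_nonneg (inv_nonneg.2 hη'.le) (le_min (norm_nonneg _) zero_le_one)
  have := lpSize_zero_le_of_le_on (P := P) (U := fun ω => f t (X t ω) - f t (Y t ω)) (V := Z t)
    (B := {ω | Y t ω ∉ K}) (a := ε / 2) (b := (min η 1)⁻¹) (ε := ε / 2) (hZc.1 t)
    (hY.1.1 t hK.isClosed.measurableSet).compl
    (ENNReal.toReal_le_of_le_ofReal (by positivity) (hKP t))
    (fun ω _ => by linarith [hm0 ω]) (fun ω hω => by
      rcases le_or_gt ‖Z t ω‖ η with hle | hgt
      · have := hinc (X t ω) (Y t ω) (not_not.1 hω) (by simpa [hXYZ] using hle) t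
        linarith [min_le_left ‖f t (X t ω) - f t (Y t ω)‖ 1, hm0 ω]
      -- Where `‖Z‖ > η`, the size of the increment is at most `1`, paid for by `Z`.
      · have h1 : min η 1 ≤ min ‖Z t ω‖ 1 := min_le_min_right _ hgt.le
        have h2 : 1 ≤ (min η 1)⁻¹ * min ‖Z t ω‖ 1 := by
          rw [inv_mul_eq_div, one_le_div hη']
          exact h1
        linarith [min_le_right ‖f t (X t ω) - f t (Y t ω)‖ 1])
  linarith

/-- Superposition preserves pseudo almost automorphy: `g(t, Y(t))` is the almost automorphic part
and `f(t, X(t)) - f(t, Y(t)) + h(t, Y(t))` the ergodic part. -/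
theorem PseudoAlmostAutomorphicInPDistribution.superposition [CompleteSpace E]
    [SecondCountableTopology F] [MeasurableSpace F] [BorelSpace F] {X : ℝ → Ω → E} {p : ℝ}
    (hX : PseudoAlmostAutomorphicInPDistribution P μ p X) (hfc : Continuous (Function.uncurry f))
    (hμ : IsWeight μ) (hp : 0 ≤ p) (hfgh : ∀ t x, f t x = g t x + h t x)
    (hg : CompactAlmostAutomorphicUniformlyOnCompacts g) (hh : ErgodicUniformlyOnCompacts μ h)
    (hf : ∀ ε : ℝ, 0 < ε → ∀ K : Set E, IsCompact K → ∃ η : ℝ, 0 < η ∧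
      ∀ x ∈ K, ∀ y ∈ K, ‖x - y‖ ≤ η → ∀ t, ‖f t x - f t y‖ ≤ ε)
    (hgrowth : 0 < p → (∃ C : ℝ, ∀ t x, ‖f t x‖ + ‖g t x‖ ≤ C * (1 + ‖x‖)) ∧
      (∃ L : ℝ, ∀ t x y, ‖f t x - f t y‖ ≤ L * ‖x - y‖)) :
    PseudoAlmostAutomorphicInPDistribution P μ p fun t ω => f t (X t ω) := by
  obtain ⟨hXc, Y, Z, ⟨hY, hYu⟩, hZ, hXYZ⟩ := hX
  obtain ⟨hYc, -⟩ := id hY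
  have hZc : IsContinuousProcess Z := by
    have : Z = fun t ω => X t ω - Y t ω := by
      funext t ω
      simp [hXYZ]
    rw [this]
    exact hXc.sub hYc
  have hgc : Continuous (Function.uncurry g) := by
    have : Function.uncurry g = fun q => Function.uncurry f q - Function.uncurry h q := by
      funext q
      simp [Function.uncurry, hfgh]
    rw [this]
    exact hfc.sub hh.1
  have hnet : ∀ K : Set E, IsCompact K → ∀ ε > 0, ∃ s : Finset E, ∀ t, ∀ y ∈ K,
      ‖h t y‖ ≤ ε + ∑ x ∈ s, ‖h t x‖ := fun K hK ε hε =>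
    exists_finset_norm_le_add_sum hfgh hf (hg.uniformlyContinuousOnStrips hgc) hK hε
  have hWc := hYc.superposition hh.1
  have hVc := (hXc.superposition hfc).sub (hYc.superposition hfc)
  refine ⟨hXc.superposition hfc, fun t ω => g t (Y t ω),
    fun t ω => (f t (X t ω) - f t (Y t ω)) + h t (Y t ω), ⟨hY.superposition hgc hg, fun hp => ?_⟩,
    ?_, fun t ω => by simp only [hfgh t (Y t ω)]; abel⟩
  · obtain ⟨⟨C, hC⟩, -⟩ := hgrowth hp
    exact hY.uniformIntegrable_norm_rpow_comp hp (hYu hp) hgc (C := C) fun t x => by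
      linarith [hC t x, norm_nonneg (f t x)]
  · rcases hp.eq_or_lt with rfl | hp
    · refine (hVc.add hWc).ergodicProcess_zero hμ ?_
      exact ((hasNullMean_lpSize_zero_increment hY hμ hZc hZ hXYZ hf).add
        (hasNullMean_lpSize_zero_comp hY hμ hh hnet)).mono fun t =>
          lpSize_zero_add_le (hVc.1 t) (hWc.1 t)
    · obtain ⟨⟨C, hC⟩, L, hL⟩ := hgrowth hp
      have hu := hY.uniformIntegrable_norm_rpow_comp hp (hYu hp) hh.1 (C := C) fun t x => by
        have h1 : h t x = f t x - g t x := by rw [hfgh]; abel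
        rw [h1]
        exact (norm_sub_le _ _).trans (hC t x)
      refine hZ.of_dominated_add hp hμ hZc hVc hWc (abs_nonneg L) (fun t ω => ?_) hu
        (hasNullMean_lpSize_comp hp hY hμ hh hu hnet)
      have h1 := hL t (X t ω) (Y t ω)
      rw [show X t ω - Y t ω = Z t ω by simp [hXYZ]] at h1
      exact h1.trans (mul_le_mul_of_nonneg_right (le_abs_self L) (norm_nonneg _))

end PseudoAlmostAutomorphy

theorem theorem3p5
    {Ω : Type*} [MeasurableSpace Ω] (P : Measure Ω) [IsProbabilityMeasure P]
    {𝕏 𝕐 : Type*}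
    [MetricSpace 𝕏] [CompleteSpace 𝕏] [SecondCountableTopology 𝕏] [MeasurableSpace 𝕏]
    [BorelSpace 𝕏]
    [MetricSpace 𝕐] [CompleteSpace 𝕐] [SecondCountableTopology 𝕐] [MeasurableSpace 𝕐]
    [BorelSpace 𝕐]
    {E F : Type*}
    [NormedAddCommGroup E] [NormedSpace ℝ E] [CompleteSpace E] [SecondCountableTopology E]
    [MeasurableSpace E] [BorelSpace E]
    [NormedAddCommGroup F] [NormedSpace ℝ F] [CompleteSpace F] [SecondCountableTopology F]
    [MeasurableSpace F] [BorelSpace F] :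
    -- almost periodicity
    (∀ (X : ℝ → Ω → 𝕏) (f : ℝ → 𝕏 → 𝕐),
      IsContinuousProcess X → Continuous (Function.uncurry f) →
      AlmostPeriodicInDistribution P X →
      AlmostPeriodicUniformlyOnCompacts f →
      AlmostPeriodicInDistribution P (fun t ω => f t (X t ω))) ∧
    -- almost automorphy
    (∀ (X : ℝ → Ω → 𝕏) (f : ℝ → 𝕏 → 𝕐),
      IsContinuousProcess X → Continuous (Function.uncurry f) →
      AlmostAutomorphicInDistribution P X →
      CompactAlmostAutomorphicUniformlyOnCompacts f →
      AlmostAutomorphicInDistribution P (fun t ω => f t (X t ω))) ∧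
    -- weighted pseudo almost automorphy
    (∀ (X : ℝ → Ω → E) (f g h : ℝ → E → F) (μ : Measure ℝ) (p : ℝ),
      IsContinuousProcess X → Continuous (Function.uncurry f) →
      IsWeight μ → 0 ≤ p →
      (∀ t x, f t x = g t x + h t x) →
      CompactAlmostAutomorphicUniformlyOnCompacts g →
      ErgodicUniformlyOnCompacts μ h →
      (∀ t, Continuous (g t)) →
      (∀ ε : ℝ, 0 < ε → ∀ K : Set E, IsCompact K → ∃ η : ℝ, 0 < η ∧
        ∀ x ∈ K, ∀ y ∈ K, ‖x - y‖ ≤ η → ∀ t, ‖f t x - f t y‖ ≤ ε) →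
      (0 < p →
        (∃ C : ℝ, ∀ t x, ‖f t x‖ + ‖g t x‖ ≤ C * (1 + ‖x‖)) ∧
        (∃ L : ℝ, ∀ t x y, ‖f t x - f t y‖ ≤ L * ‖x - y‖)) →
      PseudoAlmostAutomorphicInPDistribution P μ p X →
      PseudoAlmostAutomorphicInPDistribution P μ p (fun t ω => f t (X t ω))) := by
  refine ⟨fun X f _ hc hX hf => hX.superposition hc hf,
    fun X f _ hc hX hf => hX.superposition hc hf,
    fun X f g h μ p _ hfc hμ hp hfgh hg hh _ hf hgrowth hX =>
      hX.superposition hfc hμ hp hfgh hg hh hf hgrowth⟩
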